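/- **Instruction sequences.** Let $\mathcal F$ be a set of foci containing pairwise distinct elements $\mathrm{in}{:}i$, $\mathrm{aux}{:}i$ ($i\ge 1$) and $\mathrm{out}$, and let $\mathcal M$ be a set of methods containing $\mathrm{set}{:}\mathsf T$, $\mathrm{set}{:}\mathsf F$ and $\mathrm{get}$ (both sets are otherwise arbitrary). Basic instructions are the expressions $f.m$ with $f\in\mathcal F$, $m\in\mathcal M$. A single-pass instruction sequence is a non-empty finite sequence of primitive instructions, which are plain instructions $a$, positive tests $+a$, negative tests $-a$ ($a$ a basic instruction), forward jumps $\#l$ ($l\in\mathbb N$), and the termination instruction $!$; its length is the number of its primitive instructions. Let $IS_{br}$ be the set of those in which only the basic instructions $\mathrm{in}{:}i.\mathrm{get}$, $\mathrm{aux}{:}i.\mathrm{get}$, $\mathrm{aux}{:}i.\mathrm{set}{:}b$ and $\mathrm{out}.\mathrm{set}{:}b$ ($i\ge1$, $b\in\{\mathsf T,\mathsf F\}$) occur. **Behaviour.** The behaviour $|X|$ of $X$ is a finite thread: it is built from deadlock, termination, the internal action, and postconditional composition $p \unlhd a \unrhd q$ (perform $a$, continue as $p$ on reply $\mathsf T$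 and as $q$ on reply $\mathsf F$). Executing $a$, $+a$ or $-a$ performs $a$; execution then proceeds with the next instruction, except that the next instruction is skipped when $+a$ gets reply $\mathsf F$ or $-a$ gets reply $\mathsf T$. Executing $\#l$ proceeds with the $l$-th next instruction and deadlocks if $l=0$. Executing $!$ terminates. Running past the end is deadlock. A Boolean register holding $b$ becomes $c$ and replies $c$ on $\mathrm{set}{:}c$, stays $b$ and replies $b$ on $\mathrm{get}$, and rejects every other method. The use of a register named $f$ by a thread lets the register process all actions $f.m$ of the thread, which become internal, and leaves other actions alone. The application of a thread to a register named $f$ yields the register as it is left when the thread terminates; it yields the divergent service (which rejects everything) if the thread deadlocks or performs an action with another focus, or if a request is rejected. **The class $\mathrm{PLIS}$.** A sequence $X\in IS_{br}$ *computes* $f:\{\mathsf T,\mathsf F\}^n\to\{\mathsf T,\mathsf F\}$ if there is $l\in\mathbb N$ such that for all $b_1,\dots,b_n$ the following holds: the thread obtained from $|X|$ by using registers $\mathrm{aux}{:}1,\dots,\mathrm{aux}{:}l$ with initial content $\mathsf F$ and registers $\mathrm{in}{:}1,\dots,\mathrm{in}{:}n$ with initial contents $b_1,\dots,b_n$, applied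 to the register $\mathrm{out}$ with initial content $\mathsf F$, yields the register with content $f(b_1,\dots,b_n)$. $\mathrm{PLIS}$ is the class of all families $(f_n)_{n\in\mathbb N}$ of Boolean functions $f_n:\{\mathsf T,\mathsf F\}^n\to\{\mathsf T,\mathsf F\}$ for which there is a polynomial $h$ such that every $f_n$ is computed by some $X\in IS_{br}$ of length at most $h(n)$. **The class $\mathrm{P/poly}$.** This class of functions $f:\{\mathsf T,\mathsf F\}^*\to\{\mathsf T,\mathsf F\}$ is taken in both of its usual forms. (a) *Advice.* There are advice strings $a_n$ ($n\in\mathbb N$) of length polynomially bounded in $n$ and a function $g$ on pairs of bit strings, computable by a deterministic Turing machine in time polynomial in the length of the pair, such that $f(w)=g(w,a_{|w|})$ for all $w$. (b) *Circuits.* There is a polynomial $h$ such that for every $n$ the restriction of $f$ to $\{\mathsf T,\mathsf F\}^n$ is computed by a Boolean circuit (with constants, $\neg$-gates and binary $\wedge$- and $\vee$-gates) with at most $h(n)$ nodes. **Theorem.** Identify each family $(f_n)_{n\in\mathbb N}$ with the function $f$ on bit strings given by $f(w)=f_n(w)$ for $w\in\{\mathsf T,\mathsf F\}^n$. Then $$\mathrm{PLIS}=\mathrm{P/poly},$$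 both for $\mathrm{P/poly}$ in the sense of (a) and for $\mathrm{P/poly}$ in the sense of (b). -/

import Mathlib

namespace InstrSeq

/-! ### Foci, methods and basic actions -/

/-- Foci: the names `in:i`, `aux:i` (`i ≥ 1`) and `out` of the Boolean registers, together with an
arbitrary set `Φ` of further foci. -/
inductive Focus (Φ : Type*) where
  | inp (i : ℕ+)
  | aux (i : ℕ+)
  | out
  | other (x : Φ)

/-- Methods: the Boolean register methods `set:b` and `get`, together with an arbitrary set `M` of
further methods. -/
inductive Meth (M : Type*) where
  | set (b : Bool)
  | get
  | other (m : M)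

/-- The basic action (basic instruction) `f.m`. -/
structure Act (Φ M : Type*) where
  focus : Focus Φ
  meth : Meth M

/-! ### Threads -/

/-- Finite threads, i.e. closed terms of basic thread algebra modulo its only axiom
`x ⊴ tau ⊵ y = tau ∘ x`: the internal action `tau` only occurs as a prefix, and
`pcc x a y` is the postconditional composition `x ⊴ a ⊵ y` for a basic action `a`. -/
inductive Thread (Φ M : Type*) where
  | dead
  | term
  | tau (x : Thread Φ M)
  | pcc (x : Thread Φ M) (a : Act Φ M) (y : Thread Φ M)

/-! ### Instruction sequences -/

/-- Primitive instructions `a`, `+a`, `-a`, `#l` and `!`. -/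
inductive Instr (Φ M : Type*) where
  | plain (a : Act Φ M)
  | pos (a : Act Φ M)
  | neg (a : Act Φ M)
  | jump (l : ℕ)
  | halt

/-- Finite instruction sequences: non-empty finite sequences of primitive instructions. -/
abbrev FIS (Φ M : Type*) := {X : List (Instr Φ M) // X ≠ []}

/-- The length of a finite instruction sequence. -/
def FIS.psize {Φ M : Type*} (X : FIS Φ M) : ℕ := X.1.length

/-- Used only to show that thread extraction terminates. -/
def Instr.rank {Φ M : Type*} : Instr Φ M → ℕ
  | .pos _ => 1
  | .neg _ => 1
  | _ => 0

/-- Used only to show that thread extraction terminates. -/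
def extrMeasure {Φ M : Type*} : List (Instr Φ M) → ℕ
  | [] => 0
  | u :: x => 2 * (x.length + 1) + u.rank

theorem extrMeasure_lt {Φ M : Type*} (u : Instr Φ M) (x : List (Instr Φ M)) :
    extrMeasure x < 2 * (x.length + 1) + u.rank := by
  cases x with
  | nil => simp [extrMeasure]
  | cons v y =>
    have : v.rank ≤ 1 := by cases v <;> simp [Instr.rank]
    simp only [extrMeasure, List.length_cons]
    omega

/-- Thread extraction on sequences of instructions; running past the end is deadlock. -/
def extr {Φ M : Type*} : List (Instr Φ M) → Thread Φ M
  | [] => .dead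
  | .plain a :: x => .pcc (extr x) a (extr x)
  | .pos a :: x => .pcc (extr x) a (extr (.jump 2 :: x))
  | .neg a :: x => .pcc (extr (.jump 2 :: x)) a (extr x)
  | .jump 0 :: _ => .dead
  | .jump 1 :: x => extr x
  | .jump (_ + 2) :: [] => .dead
  | .jump (l + 2) :: _ :: x => extr (.jump (l + 1) :: x)
  | .halt :: _ => .term
termination_by x => extrMeasure x
decreasing_by
  all_goals first
    | exact extrMeasure_lt _ _
    | (simp only [extrMeasure, Instr.rank]; omega)

/-! ### Services, and their interaction with threads -/

/-- Services. Replies are `some true`, `some false`, and `none` for a rejected request. -/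
structure Service (M : Type*) where
  S : Type
  eff : Meth M → S → S
  yld : Meth M → S → Option Bool
  init : S
  blocked : ∀ m s, yld m s = none → ∀ m', yld m' (eff m s) = none

namespace Service

variable {M : Type*}

/-- The derived service after processing `m`. -/
def derive (H : Service M) (m : Meth M) : Service M := { H with init := H.eff m H.init }

/-- The reply after processing `m`. -/
def reply (H : Service M) (m : Meth M) : Option Bool := H.yld m H.init

/-- A service is divergent if it rejects every request. -/
def Divergent (H : Service M) : Prop := ∀ m, H.reply m = none

/-- The divergent service. -/
def div (M : Type*) : Service M where
  S := Unit
  eff _ _ := ()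
  yld _ _ := none
  init := ()
  blocked _ _ _ _ := rfl

/-- Sameness of services, where all divergent services are identified. -/
def Same (H H' : Service M) : Prop := H = H' ∨ (H.Divergent ∧ H'.Divergent)

end Service

/-- The common effect and yield function of Boolean registers; `none` is the rejecting state. -/
def brEff {M : Type*} : Meth M → Option Bool → Option Bool
  | .set c, some _ => some c
  | .get, some b => some b
  | .other _, some _ => none
  | _, none => none

/-- The Boolean register service with initial state `s`. -/
def BR {M : Type*} (s : Option Bool) : Service M where
  S := Option Bool
  eff := brEff
  yld := brEff
  init := s
  blocked m s h m' := by rw [h]; cases m' <;> rfl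

namespace Thread

variable {Φ M : Type*}

open Classical in
/-- The use operator: `p.use f H` is the thread that results from processing by `H` all actions of
the form `f.m` that `p` performs. -/
noncomputable def use (f : Focus Φ) : Thread Φ M → Service M → Thread Φ M
  | .term, _ => .term
  | .dead, _ => .dead
  | .tau x, H => .tau (x.use f H)
  | .pcc x a y, H =>
    if a.focus = f then
      match H.reply a.meth with
      | some true => .tau (x.use f (H.derive a.meth))
      | some false => .tau (y.use f (H.derive a.meth))
      | none => .dead
    else .pcc (x.use f H) a (y.use f H)

open Classical in
/-- The apply operator: `p.apply f H` is the service that results from processing by `H` all actions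
of the form `f.m` that `p` performs. -/
noncomputable def apply (f : Focus Φ) : Thread Φ M → Service M → Service M
  | .term, H => H
  | .dead, _ => .div M
  | .tau x, H => x.apply f H
  | .pcc x a y, H =>
    if a.focus = f then
      match H.reply a.meth with
      | some true => x.apply f (H.derive a.meth)
      | some false => y.apply f (H.derive a.meth)
      | none => .div M
    else .div M

end Thread

/-! ### Instruction sequences acting on Boolean registers -/

/-- The basic instructions `in:i.get`, `aux:i.get`, `aux:i.set:b` and `out.set:b`. -/
inductive BrAct {Φ M : Type*} : Act Φ M → Prop
  | inpGet (i : ℕ+) : BrAct ⟨.inp i, .get⟩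
  | auxGet (i : ℕ+) : BrAct ⟨.aux i, .get⟩
  | auxSet (i : ℕ+) (b : Bool) : BrAct ⟨.aux i, .set b⟩
  | outSet (b : Bool) : BrAct ⟨.out, .set b⟩

/-- Primitive instructions that, apart from jumps and termination, contain only the basic
instructions of `BrAct`. -/
def BrInstr {Φ M : Type*} : Instr Φ M → Prop
  | .plain a => BrAct a
  | .pos a => BrAct a
  | .neg a => BrAct a
  | .jump _ => True
  | .halt => True

/-- The set of instruction sequences acting on Boolean registers. -/
def ISbr (Φ M : Type*) : Set (FIS Φ M) := {X | ∀ u ∈ X.1, BrInstr u}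

/-- `(…(p / aux:1 BR_false)…) / aux:l BR_false`. -/
noncomputable def useAux {Φ M : Type*} (l : ℕ) (p : Thread Φ M) : Thread Φ M :=
  (List.range l).foldl (fun q i => q.use (.aux i.succPNat) (BR (some false))) p

/-- `(…(p / in:1 BR_{b 1})…) / in:n BR_{b n}`. -/
noncomputable def useInp {Φ M : Type*} {n : ℕ} (b : Fin n → Bool) (p : Thread Φ M) : Thread Φ M :=
  (List.finRange n).foldl (fun q i => q.use (.inp i.val.succPNat) (BR (some (b i)))) p

/-- The instruction sequence `X` computes the `n`-ary Boolean function `f`. -/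
def Computes {Φ M : Type*} {n : ℕ} (X : FIS Φ M) (f : (Fin n → Bool) → Bool) : Prop :=
  ∃ l : ℕ, ∀ b : Fin n → Bool,
    ((useInp b (useAux l (extr X.1))).apply .out (BR (some false))).Same (BR (some (f b)))

/-! ### Boolean function families and the class `PLIS` -/

/-- Boolean function families: an `n`-ary Boolean function for each `n`. -/
abbrev BoolFamily := (n : ℕ) → (Fin n → Bool) → Bool

/-- The identification of a Boolean function family with the function on bit strings that restricts
to its `n`-th member on strings of length `n`. -/
def BoolFamily.equivStringFun : BoolFamily ≃ (List Bool → Bool) where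
  toFun F w := F w.length w.get
  invFun f _ b := f (List.ofFn b)
  left_inv F := by
    have key : ∀ (n m : ℕ) (h : m = n) (b : Fin n → Bool) (c : Fin m → Bool),
        (∀ i, c i = b (Fin.cast h i)) → F m c = F n b := by
      intro n m h b c hc
      subst h
      congr 1
      funext i
      exact hc i
    funext n b
    exact key n _ List.length_ofFn b _ (fun i => List.get_ofFn b i)
  right_inv f := by
    funext w
    exact congrArg f (List.ofFn_get w)

/-- The class of all Boolean function families that can be computed by polynomial-length
instruction sequences acting on Boolean registers. -/
def PLIS (Φ M : Type*) : Set BoolFamily :=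
  {F | ∃ h : Polynomial ℕ, ∀ n : ℕ, ∃ X ∈ ISbr Φ M, Computes X (F n) ∧ X.psize ≤ h.eval n}

/-! ### `P/poly` in terms of Turing machines that take advice -/

/-- The pair of bit strings `(w, a)`, written on the tape as `w # a` with `none` as separator. -/
def pairCode (p : List Bool × List Bool) : List (Option Bool) :=
  p.1.map some ++ none :: p.2.map some

/-- The functions on bit strings that can be computed by a deterministic polynomial-time Turing
machine that takes an advice string of polynomial length, depending only on the input length. -/
def PPolyAdvice : Set (List Bool → Bool) :=
  {f | ∃ (a : ℕ → List Bool) (q : Polynomial ℕ) (g : List Bool × List Bool → Bool),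
    (∀ n, (a n).length ≤ q.eval n) ∧
    Nonempty (Turing.TM2ComputableInPolyTime pairCode Computability.encodeBool g) ∧
    ∀ w, f w = g (w, a w.length)}

/-! ### `P/poly` in terms of Boolean circuits -/

/-- Gates whose direct predecessors are taken from `α`. -/
inductive Gate (α : Type) where
  | const (b : Bool)
  | not (x : α)
  | and (x y : α)
  | or (x y : α)

/-- Boolean circuits with `n` input nodes: finite acyclic networks of gates, listed in topological
order, so that the predecessors of the `k`-th gate are input nodes and gates with number less than
`k`, with a designated output node. -/
structure Circuit (n : ℕ) where
  numGates : ℕ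
  gate : (k : Fin numGates) → Gate (Fin n ⊕ Fin k.val)
  out : Fin n ⊕ Fin numGates

namespace Circuit

variable {n : ℕ}

/-- The number of nodes of a circuit. -/
def size (C : Circuit n) : ℕ := n + C.numGates

/-- The value of the `k`-th gate on input `b`. -/
def gateVal (C : Circuit n) (b : Fin n → Bool) (k : Fin C.numGates) : Bool :=
  let val : Fin n ⊕ Fin k.val → Bool := fun x =>
    match x with
    | .inl i => b i
    | .inr j => C.gateVal b ⟨j.val, j.isLt.trans k.isLt⟩
  match C.gate k with
  | .const c => c
  | .not x => !(val x)
  | .and x y => val x && val y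
  | .or x y => val x || val y
termination_by k.val
decreasing_by exact j.isLt

/-- The Boolean function induced by a circuit. -/
def eval (C : Circuit n) (b : Fin n → Bool) : Bool :=
  match C.out with
  | .inl i => b i
  | .inr k => C.gateVal b k

end Circuit

/-- The functions on bit strings whose restrictions to strings of length `n` are computed by
circuits of size polynomial in `n`. -/
def PPolyCircuit : Set (List Bool → Bool) :=
  {f | ∃ h : Polynomial ℕ, ∀ n : ℕ, ∃ C : Circuit n,
    (∀ b : Fin n → Bool, C.eval b = f (List.ofFn b)) ∧ C.size ≤ h.eval n}

end InstrSeq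

/-!
The three classes are shown to be equal by a cycle of inclusions. Instruction sequences enter
through an operational semantics `run`, which executes an instruction sequence on register contents
and keeps track of the number of instructions that are still to be skipped; `computes_iff` says that
it captures use and application of registers on extracted threads.

*Circuits to instruction sequences* (`pPolyCircuit_subset_plis`). Every gate gets an auxiliary
register of its own, and at most four instructions compute its value from the registers of its
predecessors.

*Instruction sequences to machines with advice* (`plis_subset_pPolyAdvice`). The advice is a
translation of the instruction sequence for a fixed interpreter, a stack machine with a tape that
holds the register contents, a unary counter of the instructions to be skipped, and one bit for the
latest reply. Its operations have constant cost (move the head, load, store, flip the reply,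
conditionally increment the counter), so that it runs in linear time (`interpret_polyTime`).
An access to a register is compiled to a walk to its cell and back. Since all jumps are forward,
every instruction is visited once, and is either executed or skipped.

*Machines with advice to circuits* (`pPolyAdvice_subset_pPolyCircuit`). This is the tableau
argument. Circuits are represented by pools, lists of Boolean functions that are closed under taking
predecessors. A pool knows a value that depends on the input if it contains the indicator functions
of its possible values. A configuration of a stack machine is known if the label, the internal state
and every cell of every stack are, with cells counted from the top. Pushing and popping then only
renumber cells, and every other part of a step is a case distinction on a known value
(`Pool.gets_mux`, `gets_muxCfg`), which costs a constant number of gates for each cell. As the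
heights of the stacks are bounded by the initial height plus a multiple of the number of steps,
running the machine for polynomial time costs polynomially many gates (`gets_iterate`).
-/

namespace InstrSeq

/-! ### Running an instruction sequence on registers -/

section Run

variable {Φ M : Type*}

/-- The content of a Boolean register after processing a method that it does not reject. It is also
the reply to the request. -/
def Meth.upd : Meth M → Bool → Bool
  | .set c, _ => c
  | .get, b => b
  | .other _, b => b

open Classical in
/-- The register contents after performing a basic action. -/
noncomputable def Act.upd (a : Act Φ M) (ρ : Focus Φ → Bool) : Focus Φ → Bool :=
  Function.update ρ a.focus (a.meth.upd (ρ a.focus))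

theorem Act.upd_self (a : Act Φ M) (ρ : Focus Φ → Bool) :
    a.upd ρ a.focus = a.meth.upd (ρ a.focus) := by
  simp [Act.upd]

theorem Act.upd_of_ne (a : Act Φ M) (ρ : Focus Φ → Bool) {f : Focus Φ} (h : f ≠ a.focus) :
    a.upd ρ f = ρ f := by
  simp [Act.upd, h]

open Classical in
/-- Operational semantics of instruction sequences: `run A X k ρ` skips `k` instructions of `X` and
then executes the rest on registers with contents `ρ`. The result is the final content of `out`, and
`none` in case of deadlock or if a register with a name outside `A` is addressed. -/
noncomputable def run (A : Set (Focus Φ)) :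
    List (Instr Φ M) → ℕ → (Focus Φ → Bool) → Option Bool
  | [], _, _ => none
  | _ :: x, k + 1, ρ => run A x k ρ
  | .plain a :: x, 0, ρ => if a.focus ∈ A then run A x 0 (a.upd ρ) else none
  | .pos a :: x, 0, ρ =>
    if a.focus ∈ A then run A x (if a.upd ρ a.focus then 0 else 1) (a.upd ρ) else none
  | .neg a :: x, 0, ρ =>
    if a.focus ∈ A then run A x (if a.upd ρ a.focus then 1 else 0) (a.upd ρ) else none
  | .jump 0 :: _, 0, _ => none
  | .jump (l + 1) :: x, 0, ρ => run A x l ρ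
  | .halt :: _, 0, ρ => some (ρ .out)

/-- Threads that only perform the basic actions of `BrAct`. -/
def BrThread : Thread Φ M → Prop
  | .dead => True
  | .term => True
  | .tau x => BrThread x
  | .pcc x a y => BrThread x ∧ BrAct a ∧ BrThread y

theorem brEff_of_brAct {a : Act Φ M} (ha : BrAct a) (b : Bool) :
    brEff a.meth (some b) = some (a.meth.upd b) := by
  cases ha <;> rfl

theorem reply_BR_of_brAct {a : Act Φ M} (ha : BrAct a) (b : Bool) :
    (BR (some b)).reply a.meth = some (a.meth.upd b) :=
  brEff_of_brAct ha b

theorem derive_BR_of_brAct {a : Act Φ M} (ha : BrAct a) (b : Bool) :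
    (BR (some b)).derive a.meth = BR (some (a.meth.upd b)) :=
  congrArg BR (brEff_of_brAct ha b)

/-- Use of Boolean registers with the names in a list and contents `ρ`. -/
noncomputable def useList (L : List (Focus Φ)) (ρ : Focus Φ → Bool) (p : Thread Φ M) :
    Thread Φ M :=
  L.foldl (fun q f => q.use f (BR (some (ρ f)))) p

theorem useList_cons (f : Focus Φ) (L : List (Focus Φ)) (ρ : Focus Φ → Bool) (p : Thread Φ M) :
    useList (f :: L) ρ p = useList L ρ (p.use f (BR (some (ρ f)))) := rfl

theorem useList_congr {L : List (Focus Φ)} {ρ ρ' : Focus Φ → Bool} (h : ∀ f ∈ L, ρ f = ρ' f)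
    (p : Thread Φ M) : useList L ρ p = useList L ρ' p := by
  induction L generalizing p with
  | nil => rfl
  | cons f L ih =>
    rw [useList_cons, useList_cons, h f (by simp)]
    exact ih (fun g hg => h g (by simp [hg])) _

theorem useList_term (L : List (Focus Φ)) (ρ : Focus Φ → Bool) :
    useList L ρ (.term : Thread Φ M) = .term := by
  induction L with
  | nil => rfl
  | cons f L ih => exact ih

theorem useList_dead (L : List (Focus Φ)) (ρ : Focus Φ → Bool) :
    useList L ρ (.dead : Thread Φ M) = .dead := by
  induction L with
  | nil => rfl
  | cons f L ih => exact ih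

theorem useList_tau (L : List (Focus Φ)) (ρ : Focus Φ → Bool) (x : Thread Φ M) :
    useList L ρ (.tau x) = .tau (useList L ρ x) := by
  induction L generalizing x with
  | nil => rfl
  | cons f L ih => exact ih _

theorem useList_pcc_of_notMem {L : List (Focus Φ)} (ρ : Focus Φ → Bool) {x y : Thread Φ M}
    {a : Act Φ M} (h : a.focus ∉ L) :
    useList L ρ (.pcc x a y) = .pcc (useList L ρ x) a (useList L ρ y) := by
  induction L generalizing x y with
  | nil => rfl
  | cons f L ih =>
    simp only [List.mem_cons, not_or] at h
    simp only [useList_cons, Thread.use, if_neg h.1]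
    exact ih h.2

/-- An action on a register of the list is processed by that register alone, so that it becomes
internal and its only other effect is to update the contents. -/
theorem useList_pcc_of_mem {L : List (Focus Φ)} (hL : L.Nodup) (ρ : Focus Φ → Bool)
    {x y : Thread Φ M} {a : Act Φ M} (ha : BrAct a) (h : a.focus ∈ L) :
    useList L ρ (.pcc x a y) =
      .tau (useList L (a.upd ρ) (if a.upd ρ a.focus then x else y)) := by
  induction L generalizing x y with
  | nil => simp at h
  | cons f L ih =>
    rw [List.nodup_cons] at hL
    by_cases hf : a.focus = f
    · subst hf
      have hc : ∀ p : Thread Φ M, useList L ρ p = useList L (a.upd ρ) p :=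
        useList_congr fun g hg => (a.upd_of_ne ρ (fun e => hL.1 (e ▸ hg))).symm
      simp only [useList_cons, Thread.use, if_true, reply_BR_of_brAct ha, derive_BR_of_brAct ha,
        Act.upd_self]
      cases a.meth.upd (ρ a.focus) <;> simp [useList_tau, hc]
    · have h' : a.focus ∈ L := by simpa [hf] using h
      simp only [useList_cons, Thread.use, if_neg hf]
      rw [ih hL.2 h', a.upd_of_ne ρ (Ne.symm hf)]
      split_ifs <;> rfl

/-- The service `BR b` for an outcome `some b`, and the divergent service for `none`. -/
def outcome (M : Type*) : Option Bool → Service M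
  | some b => BR (some b)
  | none => .div M

/-- The result of applying a thread to `out` after use of the registers in `L`. -/
noncomputable def result (L : List (Focus Φ)) (ρ : Focus Φ → Bool) (p : Thread Φ M) : Service M :=
  (useList L ρ p).apply .out (BR (some (ρ .out)))

open Classical in
/-- The registers in `L` and the register `out` process actions in the same way, except that
processing by `out` leaves no internal action behind, which `result` cannot tell. -/
theorem result_pcc {L : List (Focus Φ)} (hL : L.Nodup) (ho : .out ∉ L) (ρ : Focus Φ → Bool)
    {x y : Thread Φ M} {a : Act Φ M} (ha : BrAct a) :
    result L ρ (.pcc x a y) =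
      if a.focus ∈ {f | f ∈ L ∨ f = .out} then
        result L (a.upd ρ) (if a.upd ρ a.focus then x else y) else .div M := by
  by_cases h : a.focus ∈ L
  · have hne : Focus.out ≠ a.focus := fun e => ho (e ▸ h)
    simp only [result, useList_pcc_of_mem hL ρ ha h, Thread.apply, Set.mem_ofPred_eq, h, true_or,
      if_true, a.upd_of_ne ρ hne]
  · by_cases hf : a.focus = .out
    · have hc : ∀ p : Thread Φ M, useList L ρ p = useList L (a.upd ρ) p :=
        useList_congr fun g hg => (a.upd_of_ne ρ (fun e => h (e ▸ hg))).symm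
      have hu := a.upd_self ρ
      rw [hf] at hu
      simp only [result, useList_pcc_of_notMem ρ h, Thread.apply, Set.mem_ofPred_eq, hf, or_true,
        if_true, reply_BR_of_brAct ha, derive_BR_of_brAct ha, hu]
      cases a.meth.upd (ρ .out) <;> simp [hc]
    · simp [result, useList_pcc_of_notMem ρ h, Thread.apply, hf, h]

/-- The operational semantics is adequate. The second part, on jumps, is needed for the induction,
since thread extraction turns a skipped instruction into a jump. -/
theorem result_extr {L : List (Focus Φ)} (hL : L.Nodup) (ho : .out ∉ L) (X : List (Instr Φ M))
    (hX : ∀ u ∈ X, BrInstr u) (ρ : Focus Φ → Bool) :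
    result L ρ (extr X) = outcome M (run {f | f ∈ L ∨ f = .out} X 0 ρ) ∧
    ∀ k, result L ρ (extr (.jump (k + 1) :: X)) =
      outcome M (run {f | f ∈ L ∨ f = .out} X k ρ) := by
  have hdead : result L ρ (.dead : Thread Φ M) = .div M := by
    simp [result, useList_dead, Thread.apply]
  induction X generalizing ρ with
  | nil =>
    refine ⟨by rw [extr, hdead]; rfl, fun k => ?_⟩
    cases k <;> simp [extr, hdead, run, outcome]
  | cons u X ih =>
    have hu := hX u (by simp)
    have ih := fun ρ => ih (fun v hv => hX v (by simp [hv])) ρ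
      (by simp [result, useList_dead, Thread.apply])
    have h0 : result L ρ (extr (u :: X)) =
        outcome M (run {f | f ∈ L ∨ f = .out} (u :: X) 0 ρ) := by
      cases u with
      | plain a =>
        rw [extr, result_pcc hL ho ρ hu, run, ite_self, (ih _).1]
        split_ifs <;> rfl
      | pos a =>
        rw [extr, result_pcc hL ho ρ hu, run]
        split_ifs
        · exact (ih _).1
        · exact (ih _).2 1
        · rfl
      | neg a =>
        rw [extr, result_pcc hL ho ρ hu, run]
        split_ifs
        · exact (ih _).2 1
        · exact (ih _).1
        · rfl
      | jump l =>
        cases l with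
        | zero => rw [extr, hdead]; rfl
        | succ l => rw [run]; exact (ih ρ).2 l
      | halt => simp [extr, result, useList_term, Thread.apply, run, outcome]
    refine ⟨h0, fun k => ?_⟩
    cases k with
    | zero => rw [extr]; exact h0
    | succ k => rw [extr, run]; exact (ih ρ).2 k

/-- The names of the registers that are available to an instruction sequence with inputs
`in:1, …, in:n` and auxiliary registers `aux:1, …, aux:l`. -/
def avail (Φ : Type*) (n l : ℕ) : Set (Focus Φ)
  | .inp i => (i : ℕ) ≤ n
  | .aux i => (i : ℕ) ≤ l
  | .out => True
  | .other _ => False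

/-- The initial register contents for input `b`. -/
def initReg {n : ℕ} (b : Fin n → Bool) : Focus Φ → Bool
  | .inp i => if h : i.natPred < n then b ⟨i.natPred, h⟩ else false
  | _ => false

/-- The registers with content `true` and `false` and the divergent service are pairwise not the
same, since they reply differently to `get`. -/
theorem outcome_same_iff {o : Option Bool} {c : Bool} :
    (outcome M o).Same (BR (some c)) ↔ o = some c := by
  constructor
  · rintro (h | ⟨-, h⟩)
    · cases o with
      | none =>
        have := congrArg (fun H => Service.reply H .get) h
        simp [outcome, Service.reply, Service.div, BR, brEff] at this
      | some b =>
        have := congrArg (fun H => Service.reply H .get) h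
        simpa [outcome, Service.reply, BR, brEff] using this
    · simpa [Service.reply, BR, brEff] using h .get
  · rintro rfl
    exact Or.inl rfl

/-- Computing a function in terms of the operational semantics. -/
theorem computes_iff {n : ℕ} {X : FIS Φ M} (hX : X ∈ ISbr Φ M) (f : (Fin n → Bool) → Bool) :
    Computes X f ↔ ∃ l, ∀ b, run (avail Φ n l) X.1 0 (initReg b) = some (f b) := by
  refine exists_congr fun l => forall_congr' fun b => ?_
  set L : List (Focus Φ) := (List.range l).map (fun i => .aux i.succPNat) ++
    (List.finRange n).map (fun i => .inp i.val.succPNat) with hLdef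
  have hL : L.Nodup := by
    refine List.Nodup.append (List.nodup_range.map ?_) ((List.nodup_finRange n).map ?_) ?_
    · intro i j h
      simpa using h
    · intro i j h
      simpa [Fin.ext_iff] using h
    · intro f
      simp only [List.mem_map]
      rintro ⟨i, -, rfl⟩ ⟨j, -, h⟩
      cases h
  have ho : .out ∉ L := by simp [hLdef]
  have hA : {f | f ∈ L ∨ f = .out} = avail Φ n l := by
    ext f
    change (f ∈ L ∨ f = .out) ↔ avail Φ n l f
    cases f with
    | inp i =>
      simp only [hLdef, avail, List.mem_append, List.mem_map, reduceCtorEq, and_false, exists_false,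
        false_or, or_false, Focus.inp.injEq]
      constructor
      · rintro ⟨j, -, rfl⟩
        exact j.2
      · intro h
        exact ⟨⟨i.natPred, (PNat.natPred_add_one i).trans_le h⟩, by simp, PNat.succPNat_natPred i⟩
    | aux i =>
      simp only [hLdef, avail, List.mem_append, List.mem_map, reduceCtorEq, and_false, exists_false,
        or_false, Focus.aux.injEq]
      constructor
      · rintro ⟨j, hj, rfl⟩
        exact List.mem_range.1 hj
      · intro h
        exact ⟨i.natPred, List.mem_range.2 ((PNat.natPred_add_one i).trans_le h),
          PNat.succPNat_natPred i⟩
    | out => simp [avail]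
    | other x => simp [avail, hLdef]
  have hres : useInp b (useAux l (extr X.1)) = useList L (initReg b) (extr X.1) := by
    rw [useList, hLdef, List.foldl_append, List.foldl_map, List.foldl_map]
    simp [useInp, useAux, initReg]
  rw [hres]
  change (result L (initReg b) (extr X.1)).Same _ ↔ _
  rw [(result_extr hL ho X.1 hX _).1, hA, outcome_same_iff]

end Run

/-! ### From circuits to instruction sequences -/

section CircuitToPLIS

variable {Φ M : Type*}

/-- The value of a gate, given the values of its candidate predecessors. -/
def Gate.eval {α : Type} (v : α → Bool) : Gate α → Bool
  | .const c => c
  | .not x => !(v x)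
  | .and x y => v x && v y
  | .or x y => v x || v y

theorem Circuit.gateVal_eq {n : ℕ} (C : Circuit n) (b : Fin n → Bool) (k : Fin C.numGates) :
    C.gateVal b k =
      (C.gate k).eval (Sum.elim b fun j => C.gateVal b ⟨j.val, j.isLt.trans k.isLt⟩) := by
  rw [Circuit.gateVal]
  cases C.gate k with
  | const c => rfl
  | not x => rcases x <;> rfl
  | and x y => rcases x <;> rcases y <;> rfl
  | or x y => rcases x <;> rcases y <;> rfl

/-- The register that holds the value of a node. -/
def nodeFocus {n k : ℕ} : Fin n ⊕ Fin k → Focus Φ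
  | .inl i => .inp i.val.succPNat
  | .inr j => .aux j.val.succPNat

/-- Instructions that store the value of a gate in the register `r`, provided that this register
initially contains `false`. -/
def gateCode {n k : ℕ} (r : Focus Φ) : Gate (Fin n ⊕ Fin k) → List (Instr Φ M)
  | .const c => [.plain ⟨r, .set c⟩]
  | .not x => [.neg ⟨nodeFocus x, .get⟩, .plain ⟨r, .set true⟩]
  | .and x y => [.neg ⟨nodeFocus x, .get⟩, .jump 3, .pos ⟨nodeFocus y, .get⟩,
      .plain ⟨r, .set true⟩]
  | .or x y => [.pos ⟨nodeFocus x, .get⟩, .jump 2, .pos ⟨nodeFocus y, .get⟩,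
      .plain ⟨r, .set true⟩]

theorem Act.upd_get (f : Focus Φ) (ρ : Focus Φ → Bool) : (⟨f, .get⟩ : Act Φ M).upd ρ = ρ := by
  simp [Act.upd, Meth.upd]

open Classical in
theorem Act.upd_set (f : Focus Φ) (c : Bool) (ρ : Focus Φ → Bool) :
    (⟨f, .set c⟩ : Act Φ M).upd ρ = Function.update ρ f c := by
  simp [Act.upd, Meth.upd]

open Classical in
theorem run_gateCode {n k : ℕ} {A : Set (Focus Φ)} {r : Focus Φ} (hr : r ∈ A)
    (hA : ∀ x : Fin n ⊕ Fin k, nodeFocus x ∈ A) (g : Gate (Fin n ⊕ Fin k)) {ρ : Focus Φ → Bool}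
    (hρ : ρ r = false) (X : List (Instr Φ M)) :
    run A (gateCode r g ++ X) 0 ρ =
      run A X 0 (Function.update ρ r (g.eval fun x => ρ (nodeFocus x))) := by
  have hid : Function.update ρ r false = ρ := by rw [← hρ, Function.update_eq_self]
  cases g with
  | const c => simp [gateCode, run, hr, Act.upd_set, Gate.eval]
  | not x =>
    cases h : ρ (nodeFocus x) <;>
      simp [gateCode, run, hr, hA, Act.upd_get, Act.upd_set, Gate.eval, h, hid]
  | and x y =>
    cases h : ρ (nodeFocus x) <;> cases h' : ρ (nodeFocus y) <;>
      simp [gateCode, run, hr, hA, Act.upd_get, Act.upd_set, Gate.eval, h, h', hid]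
  | or x y =>
    cases h : ρ (nodeFocus x) <;> cases h' : ρ (nodeFocus y) <;>
      simp [gateCode, run, hr, hA, Act.upd_get, Act.upd_set, Gate.eval, h, h', hid]

theorem length_gateCode_le {n k : ℕ} (r : Focus Φ) (g : Gate (Fin n ⊕ Fin k)) :
    (gateCode r g : List (Instr Φ M)).length ≤ 4 := by
  cases g <;> simp [gateCode]

theorem brAct_get_nodeFocus {n k : ℕ} (x : Fin n ⊕ Fin k) :
    BrAct (⟨nodeFocus x, .get⟩ : Act Φ M) := by
  cases x
  · exact .inpGet _
  · exact .auxGet _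

theorem brInstr_gateCode {n k : ℕ} (i : ℕ+) (g : Gate (Fin n ⊕ Fin k)) :
    ∀ u ∈ (gateCode (.aux i) g : List (Instr Φ M)), BrInstr u := by
  have hs : ∀ c, BrAct (⟨.aux i, .set c⟩ : Act Φ M) := fun c => .auxSet i c
  cases g <;> simp [gateCode, BrInstr, brAct_get_nodeFocus, hs]

/-- Register contents after the evaluation of the first `j` gates of a circuit. -/
def gateReg {n : ℕ} (C : Circuit n) (b : Fin n → Bool) (j : ℕ) : Focus Φ → Bool
  | .aux i => if h : i.natPred < C.numGates then decide (i.natPred < j) && C.gateVal b ⟨_, h⟩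
      else false
  | f => initReg b f

theorem gateReg_zero {n : ℕ} (C : Circuit n) (b : Fin n → Bool) :
    gateReg C b 0 = initReg (Φ := Φ) b := by
  funext f
  cases f <;> simp [gateReg, initReg]

open Classical in
theorem gateReg_succ {n : ℕ} (C : Circuit n) (b : Fin n → Bool) (j : Fin C.numGates) :
    gateReg (Φ := Φ) C b (j + 1) =
      Function.update (gateReg C b j) (.aux j.val.succPNat) (C.gateVal b j) := by
  funext f
  by_cases hf : f = .aux j.val.succPNat
  · subst hf
    simp [gateReg]
  · rw [Function.update_of_ne hf]
    cases f with
    | aux i =>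
      have hne : i.natPred ≠ j := by
        rintro h
        exact hf (by rw [← h, PNat.succPNat_natPred])
      have : i.natPred < (j : ℕ) + 1 ↔ i.natPred < (j : ℕ) := by omega
      simp [gateReg, this]
    | _ => rfl

/-- Every gate writes a register of its own, which contains `false` until then, as `gateCode`
requires. -/
theorem run_gates {n : ℕ} (C : Circuit n) (b : Fin n → Bool) {j : ℕ} (hj : j ≤ C.numGates)
    (X : List (Instr Φ M)) :
    run (avail Φ n C.numGates) (((List.finRange C.numGates).take j).flatMap
        (fun k => gateCode (.aux k.val.succPNat) (C.gate k)) ++ X) 0 (initReg b) =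
      run (avail Φ n C.numGates) X 0 (gateReg C b j) := by
  classical
  induction j generalizing X with
  | zero => simp [gateReg_zero]
  | succ j ih =>
    have hj' : j < (List.finRange C.numGates).length := by simpa using hj
    rw [List.take_succ_eq_append_getElem hj', List.flatMap_append, List.append_assoc,
      ih (by omega)]
    simp only [List.flatMap_cons, List.flatMap_nil, List.append_nil, List.getElem_finRange,
      Fin.cast_mk]
    rw [run_gateCode]
    · rw [gateReg_succ C b ⟨j, hj⟩, Circuit.gateVal_eq]
      congr 3
      funext x
      rcases x with i | k
      · simp [nodeFocus, gateReg, initReg]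
      · have := k.2.trans hj
        simp [nodeFocus, gateReg, this]
    · change (j.succPNat : ℕ) ≤ C.numGates
      simpa using hj
    · rintro (i | k)
      · exact i.2
      · exact k.2.trans (by omega)
    · simp [gateReg]

/-- The instruction sequence that evaluates the gates of a circuit one after another, and finally
copies the value of the output node to `out`. -/
def circuitCode {n : ℕ} (C : Circuit n) : List (Instr Φ M) :=
  (List.finRange C.numGates).flatMap
      (fun k => gateCode (.aux k.val.succPNat) (C.gate k)) ++
    [.pos ⟨nodeFocus C.out, .get⟩, .plain ⟨.out, .set true⟩, .halt]

theorem run_circuitCode {n : ℕ} (C : Circuit n) (b : Fin n → Bool) :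
    run (M := M) (avail Φ n C.numGates) (circuitCode C) 0 (initReg b) = some (C.eval b) := by
  have h := run_gates (M := M) (Φ := Φ) C b le_rfl
    [.pos ⟨nodeFocus C.out, .get⟩, .plain ⟨.out, .set true⟩, .halt]
  rw [List.take_of_length_le (by simp)] at h
  rw [circuitCode, h]
  have hA : nodeFocus C.out ∈ avail Φ n C.numGates := by
    rcases C.out with i | k
    · exact i.2
    · exact k.2
  have ho : Focus.out ∈ avail Φ n C.numGates := trivial
  have hout : gateReg C b C.numGates (.out : Focus Φ) = false := rfl
  have hv : gateReg C b C.numGates (nodeFocus C.out : Focus Φ) = C.eval b := by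
    rw [Circuit.eval]
    rcases C.out with i | k <;> simp [nodeFocus, gateReg, initReg]
  cases hc : C.eval b <;> rw [hc] at hv <;>
    simp [run, hA, ho, Act.upd_get, Act.upd_set, hv, hout]

theorem length_circuitCode_le {n : ℕ} (C : Circuit n) :
    (circuitCode C : List (Instr Φ M)).length ≤ 4 * C.numGates + 3 := by
  have : ((List.finRange C.numGates).flatMap
      (fun k => (gateCode (.aux k.val.succPNat) (C.gate k) : List (Instr Φ M)))).length ≤
        (List.finRange C.numGates).length * 4 := by
    rw [List.length_flatMap]
    refine (List.sum_le_card_nsmul _ 4 ?_).trans (by simp)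
    simp only [List.mem_map]
    rintro _ ⟨k, -, rfl⟩
    exact length_gateCode_le _ _
  simp only [circuitCode, List.length_append, List.length_cons, List.length_nil]
  simp only [List.length_finRange] at this
  omega

theorem pPolyCircuit_subset_plis :
    PPolyCircuit ⊆ BoolFamily.equivStringFun '' PLIS Φ M := by
  rintro f ⟨h, hC⟩
  -- Four instructions for each gate, and three for copying the output.
  refine ⟨BoolFamily.equivStringFun.symm f, ⟨4 * h + 3, fun n => ?_⟩, by simp⟩
  obtain ⟨C, hf, hs⟩ := hC n
  have hX : (⟨circuitCode C, by simp [circuitCode]⟩ : FIS Φ M) ∈ ISbr Φ M := by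
    intro u hu
    simp only [circuitCode, List.mem_append, List.mem_flatMap] at hu
    rcases hu with ⟨k, -, hu⟩ | hu
    · exact brInstr_gateCode _ _ u hu
    · have := brAct_get_nodeFocus (Φ := Φ) (M := M) C.out
      have h2 : BrAct (⟨.out, .set true⟩ : Act Φ M) := .outSet _
      simp only [List.mem_cons, List.not_mem_nil, or_false] at hu
      rcases hu with rfl | rfl | rfl <;> simp [BrInstr, this, h2]
  refine ⟨_, hX, (computes_iff hX _).2 ⟨C.numGates, fun b => ?_⟩, ?_⟩
  · rw [run_circuitCode, hf]
    rfl
  · refine (length_circuitCode_le C).trans ?_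
    have : C.numGates ≤ C.size := by simp [Circuit.size]
    simp only [Polynomial.eval_add, Polynomial.eval_mul, Polynomial.eval_ofNat]
    omega

end CircuitToPLIS

/-! ### Pools of Boolean functions -/

section Pool

variable {n : ℕ}

/-- A list of `n`-ary Boolean functions, containing both constants, in which every function arises
by a gate from inputs and earlier functions of the list: the functions at the nodes of a circuit. -/
structure Pool (L : List ((Fin n → Bool) → Bool)) : Prop where
  gate : ∀ k (h : k < L.length), ∃ g : Gate (Fin n ⊕ Fin k),
    ∀ b, L[k] b = g.eval (Sum.elim b fun j => L[j.val] b)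
  const : ∀ c, (fun _ => c) ∈ L

theorem gate_concat {L : List ((Fin n → Bool) → Bool)}
    (hL : ∀ k (h : k < L.length), ∃ g : Gate (Fin n ⊕ Fin k),
      ∀ b, L[k] b = g.eval (Sum.elim b fun j => L[j.val] b)) {f : (Fin n → Bool) → Bool}
    (hf : ∃ g : Gate (Fin n ⊕ Fin L.length), ∀ b, f b = g.eval (Sum.elim b fun j => L[j.val] b)) :
    ∀ k (h : k < (L ++ [f]).length), ∃ g : Gate (Fin n ⊕ Fin k),
      ∀ b, (L ++ [f])[k] b = g.eval (Sum.elim b fun j => (L ++ [f])[j.val] b) := by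
  intro k h
  rw [List.length_append, List.length_singleton] at h
  have hlt : ∀ j (hj : j < L.length), (L ++ [f])[j]'(by simp; omega) = L[j] :=
    fun j hj => List.getElem_append_left hj
  rcases Nat.lt_succ_iff_lt_or_eq.1 h with h' | rfl
  · obtain ⟨g, hg⟩ := hL k h'
    refine ⟨g, fun b => ?_⟩
    rw [hlt k h', hg]
    congr 2
    funext j
    rw [hlt j (j.2.trans h')]
  · obtain ⟨g, hg⟩ := hf
    refine ⟨g, fun b => ?_⟩
    rw [List.getElem_concat_length rfl, hg]
    congr 2
    funext j
    rw [hlt j j.2]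

theorem Pool.concat {L : List ((Fin n → Bool) → Bool)} (hL : Pool L)
    {f : (Fin n → Bool) → Bool}
    (hf : ∃ g : Gate (Fin n ⊕ Fin L.length), ∀ b, f b = g.eval (Sum.elim b fun j => L[j.val] b)) :
    Pool (L ++ [f]) :=
  ⟨gate_concat hL.gate hf, fun c => List.mem_append_left _ (hL.const c)⟩

theorem Pool.exists_circuit {L : List ((Fin n → Bool) → Bool)} (hL : Pool L)
    {f : (Fin n → Bool) → Bool} (hf : f ∈ L) :
    ∃ C : Circuit n, (∀ b, C.eval b = f b) ∧ C.numGates = L.length := by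
  choose g hg using fun k : Fin L.length => hL.gate k k.2
  obtain ⟨k, hk, rfl⟩ := List.mem_iff_getElem.1 hf
  let C : Circuit n := ⟨L.length, g, .inr ⟨k, hk⟩⟩
  have key : ∀ (b : Fin n → Bool) (m : ℕ) (hm : m < L.length), C.gateVal b ⟨m, hm⟩ = L[m] b := by
    intro b m
    induction m using Nat.strong_induction_on with
    | _ m ih =>
      intro hm
      rw [Circuit.gateVal_eq, hg ⟨m, hm⟩]
      congr 2
      funext j
      exact ih j j.2 _
  exact ⟨C, fun b => key b k hk, rfl⟩

/-- The pool `L` can be extended by at most `m` functions to a pool with the property `P`. -/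
def Gets (m : ℕ) (L : List ((Fin n → Bool) → Bool))
    (P : List ((Fin n → Bool) → Bool) → Prop) : Prop :=
  ∃ L', Pool L' ∧ L ⊆ L' ∧ L'.length ≤ L.length + m ∧ P L'

variable {L : List ((Fin n → Bool) → Bool)} {P Q : List ((Fin n → Bool) → Bool) → Prop}

theorem Gets.pure (hL : Pool L) (h : P L) (m : ℕ) : Gets m L P :=
  ⟨L, hL, fun _ h => h, by omega, h⟩

theorem Gets.bind {m m' : ℕ} (h : Gets m L P)
    (h' : ∀ L', Pool L' → L ⊆ L' → P L' → Gets m' L' Q) : Gets (m + m') L Q := by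
  obtain ⟨L', hL', hs, hl, hP⟩ := h
  obtain ⟨L'', hL'', hs', hl', hQ⟩ := h' L' hL' hs hP
  exact ⟨L'', hL'', List.Subset.trans hs hs', by omega, hQ⟩

theorem Gets.mono {m m' : ℕ} (h : Gets m L P) (hm : m ≤ m') (h' : ∀ L', Pool L' → P L' → Q L') :
    Gets m' L Q := by
  obtain ⟨L', hL', hs, hl, hP⟩ := h
  exact ⟨L', hL', hs, by omega, h' L' hL' hP⟩

theorem Gets.le {m m' : ℕ} (h : Gets m L P) (hm : m ≤ m') : Gets m' L P :=
  h.mono hm fun _ _ h => h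

/-- If each of finitely many monotone properties can be achieved at cost `m`, then all of them can
be achieved together. -/
theorem Gets.forall_mem {ι : Type*} (s : Finset ι) {m : ℕ}
    {P : ι → List ((Fin n → Bool) → Bool) → Prop} (hP : ∀ i L L', L ⊆ L' → P i L → P i L')
    (hL : Pool L) (h : ∀ i ∈ s, ∀ L', Pool L' → L ⊆ L' → Gets m L' (P i)) :
    Gets (s.card * m) L fun L' => ∀ i ∈ s, P i L' := by
  classical
  induction s using Finset.induction_on with
  | empty => exact .pure hL (by simp) _
  | insert i s hi ih =>
    rw [Finset.card_insert_of_notMem hi, add_mul, one_mul]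
    refine (ih fun j hj => h j (Finset.mem_insert_of_mem hj)).bind fun L' hL' hs hj => ?_
    obtain ⟨L'', hL'', hs', hl, hi⟩ := h i (Finset.mem_insert_self i s) L' hL' hs
    refine ⟨L'', hL'', hs', hl, fun j hj' => ?_⟩
    rcases Finset.mem_insert.1 hj' with rfl | hj'
    · exact hi
    · exact hP j _ _ hs' (hj j hj')

theorem Pool.gets_and (hL : Pool L) {f g : (Fin n → Bool) → Bool} (hf : f ∈ L) (hg : g ∈ L) :
    Gets 1 L fun L' => (fun b => f b && g b) ∈ L' := by
  obtain ⟨i, hi, rfl⟩ := List.mem_iff_getElem.1 hf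
  obtain ⟨j, hj, rfl⟩ := List.mem_iff_getElem.1 hg
  exact ⟨_, hL.concat ⟨.and (.inr ⟨i, hi⟩) (.inr ⟨j, hj⟩), fun b => rfl⟩,
    List.subset_append_left _ _, by simp,
    List.mem_append_right _ (List.mem_singleton.2 rfl)⟩

theorem Pool.gets_or (hL : Pool L) {f g : (Fin n → Bool) → Bool} (hf : f ∈ L) (hg : g ∈ L) :
    Gets 1 L fun L' => (fun b => f b || g b) ∈ L' := by
  obtain ⟨i, hi, rfl⟩ := List.mem_iff_getElem.1 hf
  obtain ⟨j, hj, rfl⟩ := List.mem_iff_getElem.1 hg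
  exact ⟨_, hL.concat ⟨.or (.inr ⟨i, hi⟩) (.inr ⟨j, hj⟩), fun b => rfl⟩,
    List.subset_append_left _ _, by simp,
    List.mem_append_right _ (List.mem_singleton.2 rfl)⟩

open Classical in
/-- The pool `L` determines the value of `φ`: it contains the indicator functions of all values. -/
def Known {A : Type*} (L : List ((Fin n → Bool) → Bool)) (φ : (Fin n → Bool) → A) : Prop :=
  ∀ a, (fun b => decide (φ b = a)) ∈ L

theorem Known.mono {A : Type*} {φ : (Fin n → Bool) → A} {L' : List ((Fin n → Bool) → Bool)}
    (h : Known L φ) (hs : L ⊆ L') : Known L' φ :=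
  fun a => hs (h a)

theorem Pool.known_const {A : Type*} (hL : Pool L) (a : A) : Known L fun _ => a := fun _ =>
  hL.const _

open Classical in
/-- The disjunction over `a ∈ s` of the conjunctions of `φ b = a` and `G a b`. -/
theorem Pool.gets_mem {A : Type*} (hL : Pool L) {φ : (Fin n → Bool) → A} (hφ : Known L φ)
    (s : Finset A) {G : A → (Fin n → Bool) → Bool} (hG : ∀ a ∈ s, G a ∈ L) :
    Gets (s.card * 2) L fun L' => (fun b => decide (φ b ∈ s) && G (φ b) b) ∈ L' := by
  induction s using Finset.induction_on with
  | empty => exact .pure hL (by simpa using hL.const false) _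
  | insert a s ha ih =>
    rw [Finset.card_insert_of_notMem ha, add_mul, one_mul]
    refine (ih fun j hj => hG j (Finset.mem_insert_of_mem hj)).bind fun L' hL' hs hm => ?_
    refine Gets.bind (m := 1) (m' := 1)
      (hL'.gets_and (hs (hφ a)) (hs (hG a (Finset.mem_insert_self a s)))) fun L'' hL'' hs' hm' => ?_
    refine (hL''.gets_or (hs' hm) hm').mono le_rfl fun L₃ _ h => ?_
    convert h using 2 with b
    by_cases hb : φ b = a
    · subst hb
      simp [ha]
    · simp [hb]

/-- Case distinction on a known value costs a number of gates that only depends on the numbers of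
possible values. -/
theorem Pool.gets_mux {A B : Type*} (hL : Pool L) {φ : (Fin n → Bool) → A} (hφ : Known L φ)
    (s : Finset A) (hs : ∀ b, φ b ∈ s) {ψ : A → (Fin n → Bool) → B} (hψ : ∀ a ∈ s, Known L (ψ a))
    (t : Finset B) (ht : ∀ b, ψ (φ b) b ∈ t) :
    Gets (t.card * (s.card * 2)) L fun L' => Known L' fun b => ψ (φ b) b := by
  classical
  refine (Gets.forall_mem t (P := fun c L' => (fun b => decide (ψ (φ b) b = c)) ∈ L')
    (fun _ _ _ h h' => h h') hL fun c _ L' hL' hs' => ?_).mono le_rfl fun L' hL' h c => ?_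
  · refine (hL'.gets_mem (hφ.mono hs') s (G := fun a b => decide (ψ a b = c))
      fun a ha => hs' (hψ a ha c)).mono le_rfl fun L'' _ h => ?_
    simpa [hs] using h
  · by_cases hc : c ∈ t
    · exact h c hc
    -- A value that is never taken has a constant indicator function, which is free.
    · have : (fun b => decide (ψ (φ b) b = c)) = fun _ => false := by
        funext b
        simp only [decide_eq_false_iff_not]
        rintro rfl
        exact hc (ht b)
      rw [this]
      exact hL'.const false

theorem Pool.gets_map {A B : Type*} (hL : Pool L) {φ : (Fin n → Bool) → A} (hφ : Known L φ)
    (s : Finset A) (hs : ∀ b, φ b ∈ s) (F : A → B) (t : Finset B) (ht : ∀ b, F (φ b) ∈ t) :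
    Gets (t.card * (s.card * 2)) L fun L' => Known L' fun b => F (φ b) :=
  hL.gets_mux hφ s hs (ψ := fun a _ => F a) (fun _ _ => hL.known_const _) t ht

theorem Pool.gets_map₂ {A B C : Type*} [Fintype C] (hL : Pool L) {φ : (Fin n → Bool) → A}
    (hφ : Known L φ) (s : Finset A) (hs : ∀ b, φ b ∈ s) {χ : (Fin n → Bool) → B} (hχ : Known L χ)
    (t : Finset B) (ht : ∀ b, χ b ∈ t) (F : A → B → C) :
    Gets (s.card * (Fintype.card C * (t.card * 2)) + Fintype.card C * (s.card * 2)) L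
      fun L' => Known L' fun b => F (φ b) (χ b) := by
  refine (Gets.forall_mem s (P := fun a L' => Known L' fun b => F a (χ b))
    (fun _ _ _ h h' => h'.mono h) hL fun a _ L' hL' hs' =>
      hL'.gets_map (hχ.mono hs') t ht (F a) Finset.univ (by simp)).bind fun L' hL' hs' h => ?_
  exact hL'.gets_mux (hφ.mono hs') s hs (ψ := fun a b => F a (χ b)) h Finset.univ (by simp)

end Pool

/-! ### Circuits for stack machines -/

section Machine

open Turing

variable {K : Type} {Γ : K → Type} {Λ σ : Type}

/-- All symbols that a statement pushes belong to `G`. -/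
def PushesIn (G : ∀ k, Finset (Γ k)) : TM2.Stmt Γ Λ σ → Prop
  | .push k f q => (∀ v, f v ∈ G k) ∧ PushesIn G q
  | .peek _ _ q => PushesIn G q
  | .pop _ _ q => PushesIn G q
  | .load _ q => PushesIn G q
  | .branch _ q₁ q₂ => PushesIn G q₁ ∧ PushesIn G q₂
  | .goto _ => True
  | .halt => True

theorem PushesIn.mono {G G' : ∀ k, Finset (Γ k)} (h : ∀ k, G k ⊆ G' k) {q : TM2.Stmt Γ Λ σ}
    (hq : PushesIn G q) : PushesIn G' q := by
  induction q with
  | push k f q ih => exact ⟨fun v => h k (hq.1 v), ih hq.2⟩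
  | peek k f q ih => exact ih hq
  | pop k f q ih => exact ih hq
  | load f q ih => exact ih hq
  | branch f q₁ q₂ ih₁ ih₂ => exact ⟨ih₁ hq.1, ih₂ hq.2⟩
  | goto f => trivial
  | halt => trivial

theorem exists_pushesIn_stmt [Fintype σ] (q : TM2.Stmt Γ Λ σ) : ∃ G, PushesIn G q := by
  classical
  induction q with
  | push k f q ih =>
    obtain ⟨G, hG⟩ := ih
    refine ⟨Function.update G k (G k ∪ Finset.univ.image f), fun v => ?_, hG.mono fun k' => ?_⟩
    · simp
    · by_cases hk : k' = k
      · subst hk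
        simp
      · simp [hk]
  | peek k f q ih => exact ih
  | pop k f q ih => exact ih
  | load f q ih => exact ih
  | branch f q₁ q₂ ih₁ ih₂ =>
    obtain ⟨G₁, h₁⟩ := ih₁
    obtain ⟨G₂, h₂⟩ := ih₂
    exact ⟨fun k => G₁ k ∪ G₂ k, h₁.mono fun k => Finset.subset_union_left,
      h₂.mono fun k => Finset.subset_union_right⟩
  | goto f => exact ⟨fun _ => ∅, trivial⟩
  | halt => exact ⟨fun _ => ∅, trivial⟩

/-- The stack alphabets of a machine may be infinite, but its finitely many statements push only
finitely many symbols, because the internal state is finite. -/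
theorem exists_pushesIn [Fintype Λ] [Fintype σ] (m : Λ → TM2.Stmt Γ Λ σ) (k₀ : K) [Fintype (Γ k₀)] :
    ∃ G : ∀ k, Finset (Γ k), (∀ l, PushesIn G (m l)) ∧ ∀ x, x ∈ G k₀ := by
  classical
  choose G hG using fun l => exists_pushesIn_stmt (m l)
  let G' : ∀ k, Finset (Γ k) := fun k => Finset.univ.biUnion fun l => G l k
  refine ⟨Function.update G' k₀ Finset.univ, fun l => (hG l).mono fun k => ?_, by simp⟩
  by_cases hk : k = k₀
  · subst hk
    simp
  · rw [Function.update_of_ne hk]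
    exact Finset.subset_biUnion_of_mem (fun l => G l k) (Finset.mem_univ l)

/-- Stacks of height at most `H` with symbols from `G`. -/
def Bounded (G : ∀ k, Finset (Γ k)) (H : ℕ) (S : ∀ k, List (Γ k)) : Prop :=
  ∀ k, (S k).length ≤ H ∧ ∀ x ∈ S k, x ∈ G k

theorem Bounded.mono {G : ∀ k, Finset (Γ k)} {H H' : ℕ} {S : ∀ k, List (Γ k)}
    (h : Bounded G H S) (hH : H ≤ H') : Bounded G H' S :=
  fun k => ⟨(h k).1.trans hH, (h k).2⟩

theorem Bounded.mem_insertNone {G : ∀ k, Finset (Γ k)} {H : ℕ} {S : ∀ k, List (Γ k)}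
    (h : Bounded G H S) (k : K) (i : ℕ) : (S k)[i]? ∈ Finset.insertNone (G k) := by
  rw [Finset.mem_insertNone]
  exact fun x hx => (h k).2 x (List.mem_of_getElem? hx)

theorem Bounded.update [DecidableEq K] {G : ∀ k, Finset (Γ k)} {H : ℕ} {S : ∀ k, List (Γ k)}
    (h : Bounded G H S) {k : K} {s : List (Γ k)} (hs : s.length ≤ H ∧ ∀ x ∈ s, x ∈ G k) :
    Bounded G H (Function.update S k s) := by
  intro k'
  by_cases hk : k' = k
  · subst hk
    simpa using hs
  · simpa [hk] using h k'

/-- The height of the stacks grows by a bounded amount when a statement is executed. -/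
theorem bounded_stepAux [DecidableEq K] {G : ∀ k, Finset (Γ k)} (q : TM2.Stmt Γ Λ σ)
    (hq : PushesIn G q) :
    ∃ D, ∀ H v S, Bounded G H S → Bounded G (H + D) (TM2.stepAux q v S).stk := by
  induction q with
  | push k f q ih =>
    obtain ⟨D, hD⟩ := ih hq.2
    refine ⟨1 + D, fun H v S hS => ?_⟩
    rw [← add_assoc]
    refine hD (H + 1) v _ ((hS.mono (by omega)).update ⟨by simpa using (hS k).1, ?_⟩)
    intro x hx
    rcases List.mem_cons.1 hx with rfl | hx
    · exact hq.1 v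
    · exact (hS k).2 x hx
  | peek k f q ih =>
    obtain ⟨D, hD⟩ := ih hq
    exact ⟨D, fun H v S hS => hD _ _ _ hS⟩
  | pop k f q ih =>
    obtain ⟨D, hD⟩ := ih hq
    refine ⟨D, fun H v S hS => hD _ _ _ (hS.update ⟨?_, fun x hx => (hS k).2 x ?_⟩)⟩
    · have := (hS k).1
      rw [List.length_tail]
      omega
    · exact List.mem_of_mem_tail hx
  | load f q ih =>
    obtain ⟨D, hD⟩ := ih hq
    exact ⟨D, fun H v S hS => hD _ _ _ hS⟩
  | branch f q₁ q₂ ih₁ ih₂ =>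
    obtain ⟨D₁, h₁⟩ := ih₁ hq.1
    obtain ⟨D₂, h₂⟩ := ih₂ hq.2
    refine ⟨D₁ + D₂, fun H v S hS => ?_⟩
    rw [TM2.stepAux]
    cases f v
    · exact (h₂ H v S hS).mono (by omega)
    · exact (h₁ H v S hS).mono (by omega)
  | goto f => exact ⟨0, fun H v S hS => hS⟩
  | halt => exact ⟨0, fun H v S hS => hS⟩

/-- The pool `L` determines all stacks, cell by cell. -/
def KnownStk {n : ℕ} (L : List ((Fin n → Bool) → Bool)) (S : (Fin n → Bool) → ∀ k, List (Γ k)) :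
    Prop :=
  ∀ (k : K) (i : ℕ), Known L fun b => (S b k)[i]?

/-- The pool `L` determines the configuration `c`. -/
def KnownCfg {n : ℕ} (L : List ((Fin n → Bool) → Bool)) (c : (Fin n → Bool) → TM2.Cfg Γ Λ σ) :
    Prop :=
  (Known L fun b => (c b).l) ∧ (Known L fun b => (c b).var) ∧ KnownStk L fun b => (c b).stk

theorem KnownStk.mono {n : ℕ} {L L' : List ((Fin n → Bool) → Bool)}
    {S : (Fin n → Bool) → ∀ k, List (Γ k)} (h : KnownStk L S) (hs : L ⊆ L') : KnownStk L' S :=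
  fun k i => (h k i).mono hs

theorem KnownCfg.mono {n : ℕ} {L L' : List ((Fin n → Bool) → Bool)}
    {c : (Fin n → Bool) → TM2.Cfg Γ Λ σ} (h : KnownCfg L c) (hs : L ⊆ L') : KnownCfg L' c :=
  ⟨h.1.mono hs, h.2.1.mono hs, h.2.2.mono hs⟩

/-- Case distinction between known configurations costs a number of gates linear in the height of
the stacks, because cells above that height are constantly empty. -/
theorem gets_muxCfg [Fintype K] [Fintype Λ] [Fintype σ] (G : ∀ k, Finset (Γ k)) {A : Type*}
    (s : Finset A) :
    ∃ C, ∀ (n H : ℕ) (L : List ((Fin n → Bool) → Bool)) (φ : (Fin n → Bool) → A)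
      (c : A → (Fin n → Bool) → TM2.Cfg Γ Λ σ), Pool L → Known L φ → (∀ b, φ b ∈ s) →
      (∀ a ∈ s, KnownCfg L (c a)) → (∀ b, Bounded G H (c (φ b) b).stk) →
      Gets (C * (H + 1)) L fun L' => KnownCfg L' fun b => c (φ b) b := by
  classical
  set W := ∑ k, (Finset.insertNone (G k)).card with hW
  refine ⟨(Fintype.card (Option Λ) * (s.card * 2) + Fintype.card σ * (s.card * 2)) +
    Fintype.card K * (W * (s.card * 2)), fun n H L φ c hL hφ hs hc hH => ?_⟩
  have h₁ := hL.gets_mux hφ s hs (ψ := fun a b => (c a b).l) (fun a ha => (hc a ha).1)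
    Finset.univ (by simp)
  have h₂ := h₁.bind fun L' hL' hs' h' => (hL'.gets_mux (hφ.mono hs') s hs
    (ψ := fun a b => (c a b).var) (fun a ha => (hc a ha).2.1.mono hs')
    Finset.univ (by simp)).bind (m' := 0) fun L'' hL'' hs'' h'' =>
      Gets.pure hL'' (⟨List.Subset.trans hs' hs'', h'.mono hs'', h''⟩ : L ⊆ L'' ∧ _ ∧ _) 0
  have h₃ := h₂.bind fun L' hL' hs' h' => (Gets.forall_mem
    ((Finset.univ : Finset K) ×ˢ Finset.range H) (m := W * (s.card * 2))
    (P := fun p L' => Known L' fun b => ((c (φ b) b).stk p.1)[p.2]?)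
    (fun _ _ _ h h' => h'.mono h) hL' fun p _ L'' hL'' hs'' =>
      (hL''.gets_mux (hφ.mono (List.Subset.trans hs' hs'')) s hs
        (ψ := fun a b => ((c a b).stk p.1)[p.2]?)
        (fun a ha => ((hc a ha).2.2 p.1 p.2).mono (List.Subset.trans hs' hs''))
        (Finset.insertNone (G p.1)) fun b => (hH b).mem_insertNone _ _).le
      (Nat.mul_le_mul_right _ (Finset.single_le_sum
        (f := fun k => (Finset.insertNone (G k)).card) (fun _ _ => Nat.zero_le _)
        (Finset.mem_univ p.1)))).bind (m' := 0) fun L'' hL'' hs'' h'' =>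
      Gets.pure hL'' (⟨h'.2.1.mono hs'', h'.2.2.mono hs'', h''⟩ : _ ∧ _ ∧ _) 0
  refine h₃.mono ?_ ?_
  · rw [Finset.card_product, Finset.card_range, Finset.card_univ, Finset.card_univ,
      Finset.card_univ]
    ring_nf
    nlinarith [Nat.zero_le (Fintype.card (Option Λ) * s.card * H),
      Nat.zero_le (Fintype.card σ * s.card * H), Nat.zero_le (Fintype.card K * W * s.card)]
  · rintro L' hL' ⟨hl, hv, hk⟩
    refine ⟨hl, hv, fun k i => ?_⟩
    by_cases hi : i < H
    · exact hk (k, i) (by simp [hi])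
    · have : (fun b => ((c (φ b) b).stk k)[i]?) = fun _ => none := by
        funext b
        exact List.getElem?_eq_none (((hH b) k).1.trans (not_lt.1 hi))
      rw [this]
      exact hL'.known_const _

theorem Pool.known_comp_injective {n : ℕ} {L : List ((Fin n → Bool) → Bool)} {A B : Type*}
    (hL : Pool L) {φ : (Fin n → Bool) → A} (hφ : Known L φ) {F : A → B}
    (hF : Function.Injective F) : Known L fun b => F (φ b) := by
  intro c
  by_cases hc : ∃ a, F a = c
  · obtain ⟨a, rfl⟩ := hc
    convert hφ a using 2
    exact decide_eq_decide.2 hF.eq_iff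
  · have : ∀ b, F (φ b) ≠ c := fun b h => hc ⟨_, h⟩
    simpa [this] using hL.const false

/-- Reading the top of a stack costs a number of gates that depends neither on the arity `n` nor on
the height of the stacks. -/
theorem gets_peek [Fintype σ] (G : ∀ k, Finset (Γ k)) (k : K) (f : σ → Option (Γ k) → σ) :
    ∃ C, ∀ (n H : ℕ) (L : List ((Fin n → Bool) → Bool)) (v : (Fin n → Bool) → σ)
      (S : (Fin n → Bool) → ∀ k, List (Γ k)), Pool L → Known L v → KnownStk L S →
      (∀ b, Bounded G H (S b)) →
      Gets C L fun L' => Known L' fun b => f (v b) (S b k).head? := by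
  refine ⟨(Finset.univ : Finset σ).card * (Fintype.card σ * ((Finset.insertNone (G k)).card * 2)) +
    Fintype.card σ * ((Finset.univ : Finset σ).card * 2), fun n H L v S hL hv hS hH => ?_⟩
  simp only [List.head?_eq_getElem?]
  exact hL.gets_map₂ hv Finset.univ (by simp) (hS k 0) (Finset.insertNone (G k))
    (fun b => (hH b).mem_insertNone k 0) f

theorem KnownStk.update [DecidableEq K] {n : ℕ} {L : List ((Fin n → Bool) → Bool)}
    {S : (Fin n → Bool) → ∀ k, List (Γ k)} (hS : KnownStk L S) (k : K)
    {s : (Fin n → Bool) → List (Γ k)} (hs : ∀ i : ℕ, Known L fun b => (s b)[i]?) :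
    KnownStk L fun b => Function.update (S b) k (s b) := by
  intro k' i
  by_cases hk : k' = k
  · subst hk
    simpa using hs i
  · simpa [hk] using hS k' i

/-- One statement of a stack machine costs a number of gates linear in the height of the stacks.
Pushing and popping merely renumber the cells, since the top of a stack is its cell `0`. -/
theorem gets_stepAux [DecidableEq K] [Fintype K] [Fintype Λ] [Fintype σ] (G : ∀ k, Finset (Γ k))
    (q : TM2.Stmt Γ Λ σ) (hq : PushesIn G q) :
    ∃ C, ∀ (n H : ℕ) (L : List ((Fin n → Bool) → Bool)) (v : (Fin n → Bool) → σ)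
      (S : (Fin n → Bool) → ∀ k, List (Γ k)), Pool L → Known L v → KnownStk L S →
      (∀ b, Bounded G H (S b)) →
      Gets (C * (H + 1)) L fun L' => KnownCfg L' fun b => TM2.stepAux q (v b) (S b) := by
  classical
  induction q with
  | push k f q ih =>
    obtain ⟨C, hC⟩ := ih hq.2
    refine ⟨(Finset.insertNone (G k)).card * ((Finset.univ : Finset σ).card * 2) + 2 * C,
      fun n H L v S hL hv hS hH => ?_⟩
    refine ((hL.gets_map hv Finset.univ (by simp) (fun a => some (f a)) (Finset.insertNone (G k))
      (fun b => by simpa using hq.1 (v b))).bind fun L' hL' hs h =>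
      hC n (H + 1) L' v (fun b => Function.update (S b) k (f (v b) :: S b k)) hL' (hv.mono hs)
        (KnownStk.update (hS.mono hs) k ?_) fun b => ?_).le ?_
    -- The new cell `0` depends on the internal state only, and cell `i + 1` is the old cell `i`.
    · rintro (_ | i)
      · exact h
      · exact (hS k i).mono hs
    · refine ((hH b).mono (Nat.le_succ H)).update ⟨by simpa using ((hH b) k).1, fun x hx => ?_⟩
      rcases List.mem_cons.1 hx with rfl | hx
      · exact hq.1 (v b)
      · exact ((hH b) k).2 x hx
    · nlinarith [Nat.zero_le (C * H), Nat.zero_le ((Finset.insertNone (G k)).card *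
        ((Finset.univ : Finset σ).card * 2) * H)]
  | peek k f q ih =>
    obtain ⟨C, hC⟩ := ih hq
    obtain ⟨D, hD⟩ := gets_peek G k f
    refine ⟨D + C, fun n H L v S hL hv hS hH => ?_⟩
    refine ((hD n H L v S hL hv hS hH).bind fun L' hL' hs h =>
      hC n H L' _ S hL' h (hS.mono hs) hH).le ?_
    nlinarith [Nat.zero_le (D * H)]
  | pop k f q ih =>
    obtain ⟨C, hC⟩ := ih hq
    obtain ⟨D, hD⟩ := gets_peek G k f
    refine ⟨D + C, fun n H L v S hL hv hS hH => ?_⟩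
    refine ((hD n H L v S hL hv hS hH).bind fun L' hL' hs h =>
      hC n H L' _ (fun b => Function.update (S b) k (S b k).tail) hL' h
        (KnownStk.update (hS.mono hs) k fun i => ?_) fun b => (hH b).update ⟨?_, ?_⟩).le ?_
    · simpa using (hS k (i + 1)).mono hs
    · have := ((hH b) k).1
      rw [List.length_tail]
      omega
    · exact fun x hx => ((hH b) k).2 x (List.mem_of_mem_tail hx)
    · nlinarith [Nat.zero_le (D * H)]
  | load f q ih =>
    obtain ⟨C, hC⟩ := ih hq
    refine ⟨(Finset.univ : Finset σ).card * ((Finset.univ : Finset σ).card * 2) + C,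
      fun n H L v S hL hv hS hH => ?_⟩
    refine ((hL.gets_map hv Finset.univ (by simp) f Finset.univ (by simp)).bind
      fun L' hL' hs h => hC n H L' _ S hL' h (hS.mono hs) hH).le ?_
    nlinarith [Nat.zero_le ((Finset.univ : Finset σ).card *
      ((Finset.univ : Finset σ).card * 2) * H)]
  | branch f q₁ q₂ ih₁ ih₂ =>
    obtain ⟨C₁, h₁⟩ := ih₁ hq.1
    obtain ⟨C₂, h₂⟩ := ih₂ hq.2
    obtain ⟨D₁, hD₁⟩ := bounded_stepAux q₁ hq.1
    obtain ⟨D₂, hD₂⟩ := bounded_stepAux q₂ hq.2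
    obtain ⟨C, hC⟩ := gets_muxCfg (Λ := Λ) (σ := σ) G (Finset.univ : Finset Bool)
    set E := (Finset.univ : Finset Bool).card * ((Finset.univ : Finset σ).card * 2)
    refine ⟨C₁ + C₂ + E + C * (D₁ + D₂ + 1), fun n H L v S hL hv hS hH => ?_⟩
    refine ((h₁ n H L v S hL hv hS hH).bind fun L₁ hL₁ hs₁ hc₁ =>
      (h₂ n H L₁ v S hL₁ (hv.mono hs₁) (hS.mono hs₁) hH).bind fun L₂ hL₂ hs₂ hc₂ =>
      (hL₂.gets_map (hv.mono (List.Subset.trans hs₁ hs₂)) Finset.univ (by simp) f Finset.univ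
        (by simp)).bind fun L₃ hL₃ hs₃ hf =>
      hC n (H + (D₁ + D₂)) L₃ (fun b => f (v b))
        (fun a b => cond a (TM2.stepAux q₁ (v b) (S b)) (TM2.stepAux q₂ (v b) (S b))) hL₃ hf
        (by simp) (fun a _ => ?_) fun b => ?_).le ?_
    · cases a
      · exact hc₂.mono hs₃
      · exact hc₁.mono (List.Subset.trans hs₂ hs₃)
    · cases f (v b)
      · exact (hD₂ H _ _ (hH b)).mono (by omega)
      · exact (hD₁ H _ _ (hH b)).mono (by omega)
    · have e : (C₁ + C₂ + E + C * (D₁ + D₂ + 1)) * (H + 1) =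
        (C₁ * (H + 1) + (C₂ * (H + 1) + (E + C * (H + (D₁ + D₂) + 1)))) +
          (E * H + C * (D₁ + D₂) * H) := by ring
      rw [e]
      exact Nat.le_add_right _ _
  | goto f =>
    refine ⟨(Finset.univ : Finset (Option Λ)).card * ((Finset.univ : Finset σ).card * 2),
      fun n H L v S hL hv hS hH => ?_⟩
    refine ((hL.gets_map hv Finset.univ (by simp) (fun a => some (f a)) Finset.univ
      (by simp)).bind (m' := 0) fun L' hL' hs h =>
        Gets.pure hL' (⟨h, hv.mono hs, hS.mono hs⟩ : _ ∧ _ ∧ _) 0).le ?_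
    nlinarith [Nat.zero_le ((Finset.univ : Finset (Option Λ)).card *
      ((Finset.univ : Finset σ).card * 2) * H)]
  | halt =>
    exact ⟨0, fun n H L v S hL hv hS hH => Gets.pure hL ⟨hL.known_const _, hv, hS⟩ _⟩

/-- The step function of a stack machine, made total by staying in halting configurations. -/
def stepOrStay [DecidableEq K] (m : Λ → TM2.Stmt Γ Λ σ) (c : TM2.Cfg Γ Λ σ) : TM2.Cfg Γ Λ σ :=
  (TM2.step m c).getD c

/-- One step of a stack machine is a case distinction between the statements of all labels, each of
which has constants of its own for the growth of the stacks and for the cost. -/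
theorem gets_stepOrStay [DecidableEq K] [Fintype K] [Fintype Λ] [Fintype σ]
    (G : ∀ k, Finset (Γ k)) (m : Λ → TM2.Stmt Γ Λ σ) (hm : ∀ l, PushesIn G (m l)) :
    ∃ C D, (∀ H c, Bounded G H c.stk → Bounded G (H + D) (stepOrStay m c).stk) ∧
      ∀ (n H : ℕ) (L : List ((Fin n → Bool) → Bool)) (c : (Fin n → Bool) → TM2.Cfg Γ Λ σ),
        Pool L → KnownCfg L c → (∀ b, Bounded G H (c b).stk) →
        Gets (C * (H + 1)) L fun L' => KnownCfg L' fun b => stepOrStay m (c b) := by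
  classical
  choose D' hD' using fun l => bounded_stepAux (m l) (hm l)
  choose C' hC' using fun l => gets_stepAux G (m l) (hm l)
  obtain ⟨E, hE⟩ := gets_muxCfg (Λ := Λ) (σ := σ) G (Finset.univ : Finset (Option Λ))
  set D := ∑ l, D' l
  have hD : ∀ H c, Bounded G H c.stk → Bounded G (H + D) (stepOrStay m c).stk := by
    rintro H ⟨_ | l, v, S⟩ h
    · exact h.mono (Nat.le_add_right _ _)
    · exact (hD' l H v S h).mono
        (Nat.add_le_add_left
          (Finset.single_le_sum (fun _ _ => Nat.zero_le _) (Finset.mem_univ l)) H)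
  refine ⟨Fintype.card Λ * ∑ l, C' l + E * (D + 1), D, hD, fun n H L c hL hc hH => ?_⟩
  have h₁ := Gets.forall_mem (Finset.univ : Finset Λ) (m := (∑ l, C' l) * (H + 1))
    (P := fun l L' => KnownCfg L' fun b => TM2.stepAux (m l) (c b).var (c b).stk)
    (fun _ _ _ h h' => h'.mono h) hL fun l _ L' hL' hs =>
      (hC' l n H L' _ _ hL' (hc.2.1.mono hs) (hc.2.2.mono hs) hH).le (Nat.mul_le_mul_right _
        (Finset.single_le_sum (f := C') (fun _ _ => Nat.zero_le _) (Finset.mem_univ l)))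
  refine (h₁.bind fun L' hL' hs h => (hE n (H + D) L' (fun b => (c b).l)
    (fun l b => l.elim (c b) fun l => TM2.stepAux (m l) (c b).var (c b).stk) hL' (hc.1.mono hs)
    (by simp) (fun l _ => ?_) fun b => ?_).mono le_rfl fun L'' _ h'' => ?_).le ?_
  · cases l with
    | none => exact hc.mono hs
    | some l => exact h l (Finset.mem_univ l)
  · have := hD H (c b) (hH b)
    rcases hb : c b with ⟨_ | l, v, S⟩ <;> rw [hb] at this <;> exact this
  · convert h'' using 2 with b
    rcases c b with ⟨_ | l, v, S⟩ <;> rfl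
  · rw [Finset.card_univ]
    have e : (Fintype.card Λ * ∑ l, C' l + E * (D + 1)) * (H + 1) =
      (Fintype.card Λ * ((∑ l, C' l) * (H + 1)) + E * (H + D + 1)) + E * D * H := by ring
    rw [e]
    exact Nat.le_add_right _ _

/-- Running a stack machine for `t` steps costs a number of gates polynomial in `t` and in the
initial height of the stacks. -/
theorem gets_iterate [DecidableEq K] [Fintype K] [Fintype Λ] [Fintype σ]
    (G : ∀ k, Finset (Γ k)) (m : Λ → TM2.Stmt Γ Λ σ) (hm : ∀ l, PushesIn G (m l)) :
    ∃ C D, ∀ (n H t : ℕ) (L : List ((Fin n → Bool) → Bool))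
      (c : (Fin n → Bool) → TM2.Cfg Γ Λ σ), Pool L → KnownCfg L c →
      (∀ b, Bounded G H (c b).stk) →
      Gets (t * (C * (H + D * t + 1))) L
        fun L' => KnownCfg L' fun b => (stepOrStay m)^[t] (c b) := by
  obtain ⟨C, D, hD, hC⟩ := gets_stepOrStay G m hm
  refine ⟨C, D, fun n H t L c hL hc hH => ?_⟩
  have hB : ∀ s b, Bounded G (H + D * s) ((stepOrStay m)^[s] (c b)).stk := by
    intro s b
    induction s with
    | zero => exact hH b
    | succ s ih =>
      rw [Function.iterate_succ_apply']
      exact (hD _ _ ih).mono (by rw [mul_add, mul_one, add_assoc])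
  have key : ∀ s ≤ t, Gets (s * (C * (H + D * t + 1))) L
      fun L' => KnownCfg L' fun b => (stepOrStay m)^[s] (c b) := by
    intro s hs
    induction s with
    | zero => exact Gets.pure hL hc _
    | succ s ih =>
      rw [add_mul, one_mul]
      refine (ih (by omega)).bind fun L' hL' _ h => ?_
      simp only [Function.iterate_succ_apply']
      exact hC n _ L' _ hL' h fun b =>
        (hB s b).mono (Nat.add_le_add_left (Nat.mul_le_mul_left _ (by omega)) _)
  exact key t le_rfl

/-- Machines may be run beyond the time at which they halt. -/
theorem iterate_stepOrStay [DecidableEq K] {m : Λ → TM2.Stmt Γ Λ σ} {c d : TM2.Cfg Γ Λ σ}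
    {s t : ℕ} (h : (flip bind (TM2.step m))^[s] (some c) = some d) (hd : TM2.step m d = none)
    (hst : s ≤ t) : (stepOrStay m)^[t] c = d := by
  have h₁ : ∀ s c, (flip bind (TM2.step m))^[s] (some c) = some d → (stepOrStay m)^[s] c = d := by
    intro s
    induction s with
    | zero => exact fun c h => Option.some.inj h
    | succ s ih =>
      intro c h
      rw [Function.iterate_succ_apply] at h ⊢
      change (flip bind (TM2.step m))^[s] (TM2.step m c) = some d at h
      cases hc : TM2.step m c with
      | none =>
        rw [hc] at h
        have : ∀ s, (flip bind (TM2.step m))^[s] none = none := fun s =>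
          Function.iterate_fixed rfl s
        rw [this] at h
        cases h
      | some c' =>
        rw [hc] at h
        rw [stepOrStay, hc]
        exact ih c' h
  obtain ⟨r, rfl⟩ := Nat.exists_eq_add_of_le' hst
  rw [Function.iterate_add_apply, h₁ s c h]
  refine Function.iterate_fixed ?_ r
  rw [stepOrStay, hd]
  rfl

end Machine

/-! ### From machines with advice to circuits -/

/-- The pool that consists of the constants, the inputs and their negations. -/
theorem exists_pool_inputs (n : ℕ) :
    ∃ L : List ((Fin n → Bool) → Bool), Pool L ∧ L.length ≤ 2 + 2 * n ∧
      ∀ i, Known L fun b => b i := by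
  have h₀ : Pool (([] ++ [fun _ => false]) ++ [fun _ => true] : List ((Fin n → Bool) → Bool)) := by
    refine ⟨gate_concat (gate_concat (fun k h => by simp at h) ⟨.const false, fun b => rfl⟩)
      ⟨.const true, fun b => rfl⟩, fun c => ?_⟩
    cases c <;> simp
  obtain ⟨L, hL, -, hl, h⟩ := Gets.forall_mem (Finset.univ : Finset (Fin n)) (m := 1 + 1)
    (P := fun i L => Known L fun b => b i) (fun _ _ _ h h' => h'.mono h) h₀ fun i _ L' hL' _ => by
      refine Gets.bind (P := fun L => (fun b => b i) ∈ L)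
        ⟨_, hL'.concat ⟨.and (.inl i) (.inl i), fun b => rfl⟩, List.subset_append_left _ _, by simp,
          List.mem_append_right _ (List.mem_singleton.2 ?_)⟩ fun L₁ hL₁ _ h₁ =>
        ⟨_, hL₁.concat ⟨.not (.inl i), fun b => rfl⟩, List.subset_append_left _ _, by simp, ?_⟩
      · funext b
        simp [Gate.eval]
      · rintro (_ | _)
        · refine List.mem_append_right _ (List.mem_singleton.2 ?_)
          funext b
          simp [Gate.eval]
        · refine List.mem_append_left _ ?_
          simpa using h₁
  refine ⟨L, hL, ?_, fun i => h i (Finset.mem_univ i)⟩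
  simp only [Finset.card_univ, Fintype.card_fin] at hl
  simp only [List.nil_append, List.length_append, List.length_singleton] at hl
  omega

theorem eval_mono_of_polynomial_nat (p : Polynomial ℕ) {x y : ℕ} (h : x ≤ y) :
    p.eval x ≤ p.eval y := by
  rw [Polynomial.eval_eq_sum, Polynomial.eval_eq_sum]
  exact Finset.sum_le_sum fun i _ => Nat.mul_le_mul_left _ (Nat.pow_le_pow_left h i)

/-- The machine is unrolled for as many steps as its time bound allows. Since the advice depends on
the input length only, it enters the initial configuration as constants, and the value of the
function is read off from the top of the output stack. -/
theorem pPolyAdvice_subset_pPolyCircuit : PPolyAdvice ⊆ PPolyCircuit := by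
  classical
  rintro f ⟨a, q, g, ha, ⟨hg⟩, hf⟩
  let tm := hg.tm
  let := tm.kFin
  let := tm.ΛFin
  let := tm.σFin
  let := tm.Γk₀Fin
  obtain ⟨G, hG, hG₀⟩ := exists_pushesIn tm.m tm.k₀
  obtain ⟨C, D, hC⟩ := gets_iterate G tm.m hG
  -- `N` bounds the length of the initial tape `w # a`, and `T` bounds the running time on it.
  let N : Polynomial ℕ := Polynomial.X + 1 + q
  let T : Polynomial ℕ := hg.time.comp N
  refine ⟨Polynomial.X + (2 + 2 * Polynomial.X +
    T * (Polynomial.C C * (N + Polynomial.C D * T + 1))),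
    fun n => ?_⟩
  let w : (Fin n → Bool) → List (tm.Γ tm.k₀) := fun b =>
    (pairCode (List.ofFn b, a n)).map hg.inputAlphabet.invFun
  have hw : ∀ b, (w b).length ≤ N.eval n := by
    intro b
    have := ha n
    simp [w, pairCode, N]
    omega
  have hwT : ∀ b : Fin n → Bool, hg.time.eval (pairCode (List.ofFn b, a n)).length ≤ T.eval n := by
    intro b
    simp only [T, Polynomial.eval_comp]
    refine eval_mono_of_polynomial_nat _ ?_
    simpa [w] using hw b
  obtain ⟨L, hL, hl, hin⟩ := exists_pool_inputs n
  have hcell : ∀ i : ℕ, Known L fun b => (w b)[i]? := by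
    intro i
    by_cases hi : i < n
    · have e : (fun b => (w b)[i]?) = fun b => some (hg.inputAlphabet.symm (some (b ⟨i, hi⟩))) := by
        funext b
        simp [w, pairCode, List.getElem?_append, hi]
      rw [e]
      exact hL.known_comp_injective (hin ⟨i, hi⟩)
        ((Option.some_injective _).comp (hg.inputAlphabet.symm.injective.comp
          (Option.some_injective _)))
    · have e : (fun b => (w b)[i]?) = fun _ =>
          ((none :: (a n).map some).map hg.inputAlphabet.symm)[i - n]? := by
        funext b
        simp only [w, pairCode, List.map_append, List.getElem?_append, List.length_map,
          List.length_ofFn, hi, if_false]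
        rfl
      rw [e]
      exact hL.known_const _
  have hc : KnownCfg L fun b => Turing.initList tm (w b) := by
    refine ⟨hL.known_const _, hL.known_const _, fun k i => ?_⟩
    by_cases hk : k = tm.k₀
    · subst hk
      simpa [Turing.initList] using hcell i
    · simpa [Turing.initList, hk] using hL.known_const _
  have hb : ∀ b, Bounded G (N.eval n) (Turing.initList tm (w b)).stk := by
    intro b k
    by_cases hk : k = tm.k₀
    · subst hk
      simpa [Turing.initList, hG₀] using hw b
    · simp [Turing.initList, hk]
  obtain ⟨L', hL', -, hl', -, -, h⟩ := hC n _ (T.eval n) L _ hL hc hb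
  obtain ⟨c, hcirc, hn⟩ := hL'.exists_circuit (h tm.k₁ 0 (some (hg.outputAlphabet.invFun true)))
  refine ⟨c, fun b => ?_, ?_⟩
  · rw [hcirc, hf]
    have ho := hg.outputsFun (List.ofFn b, a n)
    have := iterate_stepOrStay (m := tm.m) ho.evals_in_steps rfl
      (ho.steps_le_m.trans (hwT b))
    have hout : ∀ d : Turing.TM2.Cfg tm.Γ tm.Λ tm.σ,
        d = Turing.haltList tm ((Computability.encodeBool (g (List.ofFn b, a n))).map
          hg.outputAlphabet.invFun) →
        decide ((d.stk tm.k₁)[0]? = some (hg.outputAlphabet.invFun true)) =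
          g (List.ofFn b, a n) := by
      rintro _ rfl
      simp [Turing.haltList, Computability.encodeBool]
    rw [List.length_ofFn]
    convert hout _ this
  · simp only [Circuit.size, hn, Polynomial.eval_add, Polynomial.eval_mul, Polynomial.eval_X,
      Polynomial.eval_C, Polynomial.eval_ofNat, Polynomial.eval_one]
    omega

/-! ### A machine that interprets its advice -/

section Interpreter

/-- The operations of the interpreter. Advice strings are sequences of operations, with three bits
for each. -/
inductive Op
  | start
  | right
  | left
  | load
  | flip
  | store
  | skip

/-- The memory of the interpreter: a tape of bits, whose part from the current cell on is `L`, and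
whose part before the current cell is `R`, in reverse order; a unary counter `J` of the instructions
that are still to be skipped; a flag `act` telling whether the current instruction is executed; and
the latest reply `rep`. -/
structure Mem where
  L : List Bool
  R : List Bool
  J : List Bool
  act : Bool
  rep : Bool

/-- The effect of an operation. Beyond their ends, `L` and `R` are taken to continue with
`false`. -/
def Op.exec : Op → Mem → Mem
  | .start, ⟨L, R, J, _, _⟩ => ⟨L, R, J.tail, J.head?.isNone, true⟩
  | .right, ⟨L, R, J, a, r⟩ => ⟨L.tail, L.head?.getD false :: R, J, a, r⟩
  | .left, ⟨L, R, J, a, r⟩ => ⟨R.head?.getD false :: L, R.tail, J, a, r⟩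
  | .load, ⟨L, R, J, a, _⟩ => ⟨L, R, J, a, L.head?.getD false⟩
  | .flip, ⟨L, R, J, a, r⟩ => ⟨L, R, J, a, !r⟩
  | .store, ⟨L, R, J, a, r⟩ => ⟨bif a then r :: L.tail else L, R, J, a, r⟩
  | .skip, ⟨L, R, J, a, r⟩ => ⟨L, R, bif a && r then true :: J else J, a, r⟩

/-- The operation with a given code. The code `111` is redundant. -/
def Op.ofBits : Bool → Bool → Bool → Op
  | false, false, false => .start
  | false, false, true => .right
  | false, true, false => .left
  | false, true, true => .load
  | true, false, false => .flip
  | true, false, true => .store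
  | true, true, _ => .skip

/-- The code of an operation. -/
def Op.bits : Op → List Bool
  | .start => [false, false, false]
  | .right => [false, false, true]
  | .left => [false, true, false]
  | .load => [false, true, true]
  | .flip => [true, false, false]
  | .store => [true, false, true]
  | .skip => [true, true, false]

/-- Execution of a bit string; an incomplete code at the end is ignored. -/
def runBits : List Bool → Mem → Mem
  | x :: y :: z :: w, s => runBits w ((Op.ofBits x y z).exec s)
  | _, s => s

/-- The function computed by the interpreter: it executes the second string on a tape that contains
`false` followed by the reversal of the first string, and returns the first cell. -/
def interpret (p : List Bool × List Bool) : Bool :=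
  (runBits p.2 ⟨false :: p.1.reverse, [], [], false, false⟩).L.head?.getD false

/-- The names of the stacks of the interpreter. -/
inductive Stk
  | inp
  | left
  | right
  | count
  deriving DecidableEq

instance : Fintype Stk :=
  ⟨{.inp, .left, .right, .count}, fun x => by cases x <;> simp⟩

/-- The stack alphabets of the interpreter. -/
abbrev Stk.Sym : Stk → Type
  | .inp => Option Bool
  | .left => Bool
  | .right => Bool
  | .count => Bool

/-- The labels of the interpreter. -/
inductive Lbl
  | read
  | exec
  | clean
  deriving DecidableEq

instance : Fintype Lbl :=
  ⟨{.read, .exec, .clean}, fun x => by cases x <;> simp⟩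

/-- The internal states of the interpreter: the bits read last, the components `act` and `rep` of
the memory, a buffer for moved or saved bits, and whether the stacks were nonempty
when last popped. -/
structure Var where
  x : Option Bool
  y : Option Bool
  z : Option Bool
  act : Bool
  rep : Bool
  buf : Bool
  more : Bool

instance : Fintype Var :=
  Fintype.ofEquiv (Option Bool × Option Bool × Option Bool × Bool × Bool × Bool × Bool)
    ⟨fun ⟨x, y, z, a, r, b, m⟩ => ⟨x, y, z, a, r, b, m⟩,
      fun ⟨x, y, z, a, r, b, m⟩ => ⟨x, y, z, a, r, b, m⟩, fun _ => rfl, fun _ => rfl⟩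

/-- The initial internal state of the interpreter. -/
def Var.init : Var := ⟨none, none, none, false, false, false, false⟩

/-- The operation whose code has been read. -/
def Var.op (v : Var) : Op := Op.ofBits (v.x.getD false) (v.y.getD false) (v.z.getD false)

open Turing.TM2.Stmt in
/-- The statement that executes the operation whose code has been read. -/
def opStmt : Turing.TM2.Stmt Stk.Sym Lbl Var :=
  branch (fun v => v.op matches .start)
    (pop .count (fun v s => { v with act := s.isNone, rep := true }) (goto fun _ => .exec)) <|
  branch (fun v => v.op matches .right)
    (pop .left (fun v s => { v with buf := s.getD false }) <|
      push .right (fun v => v.buf) (goto fun _ => .exec)) <|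
  branch (fun v => v.op matches .left)
    (pop .right (fun v s => { v with buf := s.getD false }) <|
      push .left (fun v => v.buf) (goto fun _ => .exec)) <|
  branch (fun v => v.op matches .load)
    (peek .left (fun v s => { v with rep := s.getD false }) (goto fun _ => .exec)) <|
  branch (fun v => v.op matches .flip)
    (load (fun v => { v with rep := !v.rep }) (goto fun _ => .exec)) <|
  branch (fun v => v.op matches .store)
    (branch (fun v => v.act)
      (pop .left (fun v _ => v) <| push .left (fun v => v.rep) (goto fun _ => .exec))
      (goto fun _ => .exec)) <|
  branch (fun v => v.act && v.rep)
    (push .count (fun _ => true) (goto fun _ => .exec))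
    (goto fun _ => .exec)

open Turing.TM2.Stmt in
/-- The program of the interpreter. It moves the first string to the tape, executes the second
string, and finally empties all stacks. -/
def program : Lbl → Turing.TM2.Stmt Stk.Sym Lbl Var
  | .read =>
    pop .inp (fun v s => { v with x := s.join }) <|
    branch (fun v => v.x.isSome)
      (push .left (fun v => v.x.getD false) (goto fun _ => .read))
      (push .left (fun _ => false) (goto fun _ => .exec))
  | .exec =>
    pop .inp (fun v s => { v with x := s.join }) <|
    pop .inp (fun v s => { v with y := s.join }) <|
    pop .inp (fun v s => { v with z := s.join }) <|
    branch (fun v => v.z.isSome) opStmt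
      (peek .left (fun v s => { v with buf := s.getD false }) (goto fun _ => .clean))
  | .clean =>
    pop .left (fun v s => { v with more := s.isSome }) <|
    pop .right (fun v s => { v with more := v.more || s.isSome }) <|
    pop .count (fun v s => { v with more := v.more || s.isSome }) <|
    branch (fun v => v.more)
      (goto fun _ => .clean)
      (push .left (fun v => v.buf) <| load (fun _ => .init) halt)

/-- The interpreter as a bundled machine. -/
def interpreter : Turing.FinTM2 where
  K := Stk
  k₀ := .inp
  k₁ := .left
  Γ := Stk.Sym
  Λ := Lbl
  main := .read
  σ := Var
  initialState := .init
  Γk₀Fin := inferInstanceAs (Fintype (Option Bool))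
  m := program

/-- The stacks with given contents. -/
def stks (i : List (Option Bool)) (L R J : List Bool) : ∀ k : Stk, List k.Sym
  | .inp => i
  | .left => L
  | .right => R
  | .count => J

section

variable (i i' : List (Option Bool)) (L R J s : List Bool)

@[simp] theorem stks_inp : stks i L R J .inp = i := rfl
@[simp] theorem stks_left : stks i L R J .left = L := rfl
@[simp] theorem stks_right : stks i L R J .right = R := rfl
@[simp] theorem stks_count : stks i L R J .count = J := rfl

@[simp] theorem update_stks_inp : Function.update (stks i L R J) .inp i' = stks i' L R J := by
  funext k
  cases k <;> rfl

@[simp] theorem update_stks_left : Function.update (stks i L R J) .left s = stks i s R J := by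
  funext k
  cases k <;> rfl

@[simp] theorem update_stks_right : Function.update (stks i L R J) .right s = stks i L s J := by
  funext k
  cases k <;> rfl

@[simp] theorem update_stks_count : Function.update (stks i L R J) .count s = stks i L R s := by
  funext k
  cases k <;> rfl

end

/-- The interpreter gets from `c` to `d` in at most `t` steps. -/
def Reach (t : ℕ) (c d : Turing.TM2.Cfg Stk.Sym Lbl Var) : Prop :=
  ∃ s ≤ t, (flip bind (Turing.TM2.step program))^[s] (some c) = some d

theorem Reach.head {t : ℕ} {c c' d : Turing.TM2.Cfg Stk.Sym Lbl Var}
    (h : Turing.TM2.step program c = some c') (h' : Reach t c' d) : Reach (t + 1) c d := by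
  obtain ⟨s, hs, h'⟩ := h'
  refine ⟨s + 1, by omega, ?_⟩
  rw [Function.iterate_succ_apply]
  change (flip bind (Turing.TM2.step program))^[s] (Turing.TM2.step program c) = _
  rw [h, h']

theorem Reach.mono {t t' : ℕ} {c d : Turing.TM2.Cfg Stk.Sym Lbl Var} (h : Reach t c d)
    (ht : t ≤ t') : Reach t' c d := by
  obtain ⟨s, hs, h⟩ := h
  exact ⟨s, hs.trans ht, h⟩

/-- The reading phase moves the first string to the tape, which reverses it, and puts `false` in
front. -/
theorem reach_read {t : ℕ} {d : Turing.TM2.Cfg Stk.Sym Lbl Var} (i : List (Option Bool))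
    (w L : List Bool) (v : Var)
    (h : ∀ v' : Var, v'.act = v.act → v'.rep = v.rep →
      Reach t ⟨some .exec, v', stks i (false :: (w.reverse ++ L)) [] []⟩ d) :
    Reach (t + 1 + w.length) ⟨some .read, v, stks (w.map some ++ none :: i) L [] []⟩ d := by
  induction w generalizing L v with
  | nil =>
    exact .head (c' := ⟨some .exec, { v with x := none }, stks i (false :: L) [] []⟩)
      (by simp [program]) (h _ rfl rfl)
  | cons x w ih =>
    refine .head (c' := ⟨some .read, { v with x := some x },
      stks (w.map some ++ none :: i) (x :: L) [] []⟩) (by simp [program]) (ih _ _ ?_)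
    intro v' h₁ h₂
    simpa using h v' h₁ h₂

theorem step_exec {i : List (Option Bool)} {x y z : Bool} (s : Mem) (v : Var)
    (hact : v.act = s.act) (hrep : v.rep = s.rep) :
    ∃ v' : Var, v'.act = ((Op.ofBits x y z).exec s).act ∧
      v'.rep = ((Op.ofBits x y z).exec s).rep ∧
      Turing.TM2.step program
        ⟨some .exec, v, stks (some x :: some y :: some z :: i) s.L s.R s.J⟩ =
        some ⟨some .exec, v', stks i ((Op.ofBits x y z).exec s).L ((Op.ofBits x y z).exec s).R
          ((Op.ofBits x y z).exec s).J⟩ := by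
  obtain ⟨L, R, J, a, r⟩ := s
  obtain ⟨vx, vy, vz, va, vr, vb, vm⟩ := v
  dsimp only at hact hrep
  subst hact hrep
  have hstep : Turing.TM2.step program
      ⟨some .exec, ⟨vx, vy, vz, va, vr, vb, vm⟩, stks (some x :: some y :: some z :: i) L R J⟩ =
      some (Turing.TM2.stepAux opStmt ⟨some x, some y, some z, va, vr, vb, vm⟩ (stks i L R J)) := by
    simp [program]
  rw [hstep]
  simp only [Option.some.injEq, opStmt, Turing.TM2.stepAux, Var.op, Option.getD_some]
  cases h : Op.ofBits x y z
  case store => cases va <;> simp [Op.exec]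
  case skip => cases va <;> cases vr <;> simp [Op.exec]
  all_goals simp [Op.exec]

/-- The execution phase runs the second string and saves the first cell of the tape. -/
theorem reach_exec {t : ℕ} {d : Turing.TM2.Cfg Stk.Sym Lbl Var} (a : List Bool) (s : Mem) (v : Var)
    (hact : v.act = s.act) (hrep : v.rep = s.rep)
    (h : ∀ v' : Var, v'.buf = (runBits a s).L.head?.getD false →
      Reach t ⟨some .clean, v', stks [] (runBits a s).L (runBits a s).R (runBits a s).J⟩ d) :
    Reach (t + 1 + a.length) ⟨some .exec, v, stks (a.map some) s.L s.R s.J⟩ d := by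
  induction a, s using runBits.induct generalizing v with
  | case1 x y z w s ih =>
    obtain ⟨v', h₁, h₂, hs⟩ := step_exec (i := w.map some) (x := x) (y := y) (z := z) s v hact hrep
    exact (Reach.head hs (ih v' h₁ h₂ h)).mono (by simp; omega)
  | case2 a s ha =>
    have e : runBits a s = s := by
      rw [runBits]
      exact ha
    rw [e] at h
    refine (Reach.head (c' := ⟨some .clean, { v with
      x := a[0]?, y := a[1]?, z := none, buf := s.L.head?.getD false }, stks [] s.L s.R s.J⟩) ?_
      (h _ rfl)).mono (by omega)
    match a with
    | [] => simp [program]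
    | [x] => simp [program]
    | [x, y] => simp [program]
    | x :: y :: z :: w => exact (ha x y z w rfl).elim

/-- The cleaning phase empties the stacks, as required of halting configurations, and outputs the
saved bit. -/
theorem reach_clean (N : ℕ) (L R J : List Bool) (v : Var) (hL : L.length ≤ N) (hR : R.length ≤ N)
    (hJ : J.length ≤ N) :
    Reach (N + 1) ⟨some .clean, v, stks [] L R J⟩ ⟨none, .init, stks [] [v.buf] [] []⟩ := by
  induction N generalizing L R J v with
  | zero =>
    obtain rfl := List.eq_nil_of_length_eq_zero (Nat.le_zero.1 hL)
    obtain rfl := List.eq_nil_of_length_eq_zero (Nat.le_zero.1 hR)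
    obtain rfl := List.eq_nil_of_length_eq_zero (Nat.le_zero.1 hJ)
    exact .head (by simp [program]) ⟨0, le_rfl, rfl⟩
  | succ N ih =>
    by_cases hne : (L.head?.isSome || R.head?.isSome || J.head?.isSome) = true
    · refine .head (c' := ⟨some .clean, { v with more := true }, stks [] L.tail R.tail J.tail⟩) ?_
        (ih _ _ _ _ (by simp; omega) (by simp; omega) (by simp; omega))
      simp [program, hne]
    · obtain ⟨rfl, rfl, rfl⟩ : L = [] ∧ R = [] ∧ J = [] := by
        cases L <;> cases R <;> cases J <;> simp at hne ⊢
      exact .head (by simp [program]) ⟨0, Nat.zero_le _, rfl⟩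

/-- Each operation pushes at most one more symbol than it pops. This bounds the time of the cleaning
phase. -/
theorem length_runBits_le (a : List Bool) (s : Mem) :
    (runBits a s).L.length + (runBits a s).R.length + (runBits a s).J.length ≤
      s.L.length + s.R.length + s.J.length + a.length := by
  induction a, s using runBits.induct with
  | case1 x y z w s ih =>
    rw [runBits]
    refine ih.trans ?_
    obtain ⟨L, R, J, a, r⟩ := s
    have hlen : ∀ o : Op, (o.exec ⟨L, R, J, a, r⟩).L.length + (o.exec ⟨L, R, J, a, r⟩).R.length +
        (o.exec ⟨L, R, J, a, r⟩).J.length ≤ L.length + R.length + J.length + 1 := by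
      intro o
      cases o <;> simp only [Op.exec, List.length_cons, List.length_tail]
      case store => cases a <;> simp; omega
      case skip => cases a <;> cases r <;> simp; omega
      all_goals omega
    have := hlen (Op.ofBits x y z)
    simp only [List.length_cons]
    omega
  | case2 a s ha =>
    have e : runBits a s = s := by
      rw [runBits]
      exact ha
    rw [e]
    omega

theorem reach_interpret (w a : List Bool) :
    Reach (2 * (pairCode (w, a)).length + 4) ⟨some .read, .init, stks (pairCode (w, a)) [] [] []⟩
      ⟨none, .init, stks [] [interpret (w, a)] [] []⟩ := by
  have hlen := length_runBits_le a ⟨false :: w.reverse, [], [], false, false⟩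
  simp only [List.length_cons, List.length_reverse, List.length_nil] at hlen
  refine (reach_read (a.map some) w [] .init (t := w.length + 1 + a.length + 1 + 1 + a.length)
    fun v h₁ h₂ => ?_).mono ?_
  · rw [List.append_nil]
    refine reach_exec a ⟨false :: w.reverse, [], [], false, false⟩ v h₁ h₂ fun v' h => ?_
    rw [interpret, ← h]
    exact reach_clean _ _ _ _ _ (by omega) (by omega) (by omega)
  · simp [pairCode]
    omega

theorem interpret_polyTime :
    Nonempty (Turing.TM2ComputableInPolyTime pairCode Computability.encodeBool interpret) := by
  have hinit : ∀ s, Turing.initList interpreter s = ⟨some .read, .init, stks s [] [] []⟩ := by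
    intro s
    rw [Turing.initList]
    congr 1
    funext k
    cases k <;> rfl
  have hhalt : ∀ b, Turing.haltList interpreter [b] = ⟨none, .init, stks [] [b] [] []⟩ := by
    intro b
    rw [Turing.haltList]
    congr 1
    funext k
    cases k <;> rfl
  choose t ht hr using fun p : List Bool × List Bool => reach_interpret p.1 p.2
  refine ⟨⟨interpreter, Equiv.refl _, Equiv.refl _⟩, 2 * Polynomial.X + 4, fun p => ⟨⟨t p, ?_⟩, ?_⟩⟩
  · change (flip bind (Turing.TM2.step program))^[t p]
      (some (Turing.initList interpreter ((pairCode p).map id))) =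
        some (Turing.haltList interpreter [interpret p])
    have e : Turing.initList interpreter ((pairCode p).map id) =
        ⟨some .read, .init, stks (pairCode p) [] [] []⟩ :=
      (congrArg (Turing.initList interpreter) (List.map_id (pairCode p))).trans (hinit _)
    exact (congrArg (fun c => (flip bind (Turing.TM2.step program))^[t p] (some c)) e).trans
      ((hr p).trans (congrArg some (hhalt _).symm))
  · simpa using ht p

end Interpreter

/-! ### From instruction sequences to machines with advice -/

section PLISToAdvice

variable {Φ M : Type*}

/-- Execution of a sequence of operations. -/
def execs (ops : List Op) (s : Mem) : Mem :=
  ops.foldl (fun s o => o.exec s) s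

theorem execs_append (ops ops' : List Op) (s : Mem) :
    execs (ops ++ ops') s = execs ops' (execs ops s) :=
  List.foldl_append

theorem execs_cons (o : Op) (ops : List Op) (s : Mem) :
    execs (o :: ops) s = execs ops (o.exec s) := rfl

theorem runBits_flatMap_bits (ops : List Op) (s : Mem) :
    runBits (ops.flatMap Op.bits) s = execs ops s := by
  induction ops generalizing s with
  | nil => rfl
  | cons o ops ih =>
    rw [execs_cons, ← ih, List.flatMap_cons]
    cases o <;> rfl

theorem length_flatMap_bits (ops : List Op) : (ops.flatMap Op.bits).length = 3 * ops.length := by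
  induction ops with
  | nil => rfl
  | cons o ops ih =>
    rw [List.flatMap_cons, List.length_append, ih, List.length_cons]
    cases o <;> simp [Op.bits] <;> omega

/-- Perform the operation `o` at the cell with number `i`. -/
def opAt (i : ℕ) (o : Op) : List Op :=
  List.replicate i .right ++ o :: List.replicate i .left

theorem opAt_succ (i : ℕ) (o : Op) : opAt (i + 1) o = .right :: (opAt i o ++ [.left]) := by
  rw [opAt, List.replicate_succ, List.replicate_succ' (a := Op.left)]
  simp [opAt]

/-- If an operation, applied at the head of the tape, writes `c x` and replies `r x` where `x` is
the content of the current cell, then `opAt` does so for the cell with number `i`. -/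
theorem execs_opAt {o : Op} {c r : Bool → Bool} {J : List Bool} {a p : Bool}
    (ho : ∀ L R, ∃ L', o.exec ⟨L, R, J, a, p⟩ = ⟨L', R, J, a, r (L.getD 0 false)⟩ ∧
      ∀ j, L'.getD j false = if j = 0 then c (L.getD 0 false) else L.getD j false)
    (i : ℕ) (L R : List Bool) :
    ∃ L', execs (opAt i o) ⟨L, R, J, a, p⟩ = ⟨L', R, J, a, r (L.getD i false)⟩ ∧
      ∀ j, L'.getD j false = if j = i then c (L.getD i false) else L.getD j false := by
  induction i generalizing L R with
  | zero => exact ho L R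
  | succ i ih =>
    obtain ⟨L', he, hL'⟩ := ih L.tail (L.head?.getD false :: R)
    have ht : ∀ j, L.tail.getD j false = L.getD (j + 1) false := by
      intro j
      cases L <;> simp
    refine ⟨L.head?.getD false :: L', ?_, ?_⟩
    · rw [opAt_succ, execs_cons, execs_append, Op.exec, he, ht]
      rfl
    · rintro (_ | j)
      · cases L <;> simp
      · rw [List.getD_cons_succ, hL' j, ht, ht]
        simp

theorem execs_load (i : ℕ) (L R J : List Bool) (a p : Bool) :
    ∃ L', execs (opAt i .load) ⟨L, R, J, a, p⟩ = ⟨L', R, J, a, L.getD i false⟩ ∧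
      ∀ j, L'.getD j false = L.getD j false := by
  obtain ⟨L', h, h'⟩ := execs_opAt (o := .load) (c := id) (r := id) (J := J) (a := a) (p := p)
    (fun L R => ⟨L, by cases L <;> rfl, fun j => by simp; rintro rfl; rfl⟩) i L R
  refine ⟨L', h, fun j => ?_⟩
  rw [h' j]
  split_ifs with hj
  · rw [hj, id]
  · rfl

theorem execs_store (i : ℕ) (L R J : List Bool) (a p : Bool) :
    ∃ L', execs (opAt i .store) ⟨L, R, J, a, p⟩ = ⟨L', R, J, a, p⟩ ∧
      ∀ j, L'.getD j false = if a = true ∧ j = i then p else L.getD j false := by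
  obtain ⟨L', h, h'⟩ := execs_opAt (o := .store) (c := fun x => bif a then p else x)
    (r := fun _ => p) (J := J) (a := a) (p := p)
    (fun L R => ⟨_, rfl, fun j => by cases a <;> cases L <;> cases j <;> simp⟩) i L R
  refine ⟨L', h, fun j => ?_⟩
  rw [h' j]
  cases a
  · by_cases hj : j = i <;> simp [hj]
  · simp

theorem execs_replicate_skip (m : ℕ) (L R J : List Bool) (a : Bool) :
    execs (List.replicate m .skip) ⟨L, R, J, a, true⟩ =
      ⟨L, R, bif a then List.replicate m true ++ J else J, a, true⟩ := by
  induction m generalizing J with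
  | zero => cases a <;> rfl
  | succ m ih =>
    rw [List.replicate_succ, execs_cons, Op.exec, ih]
    cases a
    · rfl
    · simp [List.replicate_succ']

variable (addr : Focus Φ → ℕ)

/-- Operations that perform a basic action, where the content of the register `f` is kept in the
cell with number `addr f`. The latest reply has to be `true`. -/
def actCode (a : Act Φ M) : List Op :=
  match a.meth with
  | .get => opAt (addr a.focus) .load
  | .set true => opAt (addr a.focus) .store
  | .set false => .flip :: opAt (addr a.focus) .store
  | .other _ => []

/-- Operations that perform an instruction that is followed by `r` instructions. Termination is
achieved by skipping all of these. Jumps are cut off at `r`, as any longer jump deadlocks; hence the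
length of the code does not depend on the length of jumps. The jump `#0` is treated like `#1`, which
is harmless because it occurs in no run that terminates. -/
def instrCode (r : ℕ) : Instr Φ M → List Op
  | .plain a => .start :: actCode addr a
  | .pos a => .start :: (actCode addr a ++ [.flip, .skip])
  | .neg a => .start :: (actCode addr a ++ [.skip])
  | .jump l => .start :: List.replicate (min (l - 1) r) .skip
  | .halt => .start :: List.replicate r .skip

/-- Operations that perform an instruction sequence. -/
def seqCode : List (Instr Φ M) → List Op
  | [] => []
  | u :: x => instrCode addr x.length u ++ seqCode x

/-- The tape `L` represents the contents `ρ` of the registers in `B`. -/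
def Represents (B : Set (Focus Φ)) (L : List Bool) (ρ : Focus Φ → Bool) : Prop :=
  ∀ f ∈ B, L.getD (addr f) false = ρ f

variable {addr}

theorem execs_actCode_inactive (a : Act Φ M) (L R J : List Bool) (p : Bool) :
    ∃ L' p', execs (actCode addr a) ⟨L, R, J, false, p⟩ = ⟨L', R, J, false, p'⟩ ∧
      ∀ j, L'.getD j false = L.getD j false := by
  rw [actCode]
  split
  · obtain ⟨L', h, h'⟩ := execs_load (addr a.focus) L R J false p
    exact ⟨L', _, h, h'⟩
  · obtain ⟨L', h, h'⟩ := execs_store (addr a.focus) L R J false p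
    exact ⟨L', _, h, fun j => by simpa using h' j⟩
  · obtain ⟨L', h, h'⟩ := execs_store (addr a.focus) L R J false (!p)
    exact ⟨L', _, h, fun j => by simpa using h' j⟩
  · exact ⟨L, p, rfl, fun _ => rfl⟩

theorem execs_actCode {B : Set (Focus Φ)} (hB : Set.InjOn addr B) {a : Act Φ M} (ha : BrAct a)
    (hf : a.focus ∈ B) {L : List Bool} {ρ : Focus Φ → Bool} (hL : Represents addr B L ρ)
    (R J : List Bool) :
    ∃ L', execs (actCode addr a) ⟨L, R, J, true, true⟩ = ⟨L', R, J, true, a.upd ρ a.focus⟩ ∧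
      Represents addr B L' (a.upd ρ) := by
  have hget : a.meth = .get → ∃ L', execs (actCode addr a) ⟨L, R, J, true, true⟩ =
      ⟨L', R, J, true, a.upd ρ a.focus⟩ ∧ Represents addr B L' (a.upd ρ) := by
    intro hm
    obtain ⟨L', h, h'⟩ := execs_load (addr a.focus) L R J true true
    have hu : a.upd ρ = ρ := by simp [Act.upd, hm, Meth.upd]
    refine ⟨L', ?_, fun f hf => ?_⟩
    · rw [actCode, hm, hu, ← hL _ hf]
      exact h
    · rw [h', hu, hL f hf]
  have hset : ∀ c, a.meth = .set c → ∃ L', execs (actCode addr a) ⟨L, R, J, true, true⟩ =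
      ⟨L', R, J, true, a.upd ρ a.focus⟩ ∧ Represents addr B L' (a.upd ρ) := by
    intro c hm
    obtain ⟨L', h, h'⟩ := execs_store (addr a.focus) L R J true c
    refine ⟨L', ?_, fun f hf' => ?_⟩
    · rw [actCode, hm, a.upd_self, hm]
      cases c <;> exact h
    · rw [h']
      by_cases e : f = a.focus
      · rw [e, a.upd_self, hm]
        simp [Meth.upd]
      · rw [a.upd_of_ne ρ e, if_neg fun e' => e (hB hf' hf e'.2), hL f hf']
  cases ha with
  | inpGet i => exact hget rfl
  | auxGet i => exact hget rfl
  | auxSet i c => exact hset c rfl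
  | outSet c => exact hset c rfl

theorem execs_instrCode_inactive (r : ℕ) (u : Instr Φ M) (L R J : List Bool) (x a p : Bool) :
    ∃ L' p', execs (instrCode addr r u) ⟨L, R, x :: J, a, p⟩ = ⟨L', R, J, false, p'⟩ ∧
      ∀ j, L'.getD j false = L.getD j false := by
  cases u with
  | plain b => exact execs_actCode_inactive b L R J true
  | pos b =>
    obtain ⟨L', p', h, h'⟩ := execs_actCode_inactive (addr := addr) b L R J true
    refine ⟨L', !p', ?_, h'⟩
    rw [instrCode, execs_cons, execs_append]
    exact congrArg (execs [.flip, .skip]) h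
  | neg b =>
    obtain ⟨L', p', h, h'⟩ := execs_actCode_inactive (addr := addr) b L R J true
    refine ⟨L', p', ?_, h'⟩
    rw [instrCode, execs_cons, execs_append]
    exact congrArg (execs [.skip]) h
  | jump l => exact ⟨L, true, execs_replicate_skip _ L R J false, fun _ => rfl⟩
  | halt => exact ⟨L, true, execs_replicate_skip _ L R J false, fun _ => rfl⟩

/-- An instruction sequence that is skipped completely does not change the tape. -/
theorem execs_seqCode_inactive (X : List (Instr Φ M)) {L R J : List Bool} {a p : Bool}
    (hJ : X.length ≤ J.length) (j : ℕ) :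
    (execs (seqCode addr X) ⟨L, R, J, a, p⟩).L.getD j false = L.getD j false := by
  induction X generalizing L J a p with
  | nil => rfl
  | cons u X ih =>
    obtain _ | ⟨x, J⟩ := J
    · simp at hJ
    · obtain ⟨L', p', h, h'⟩ := execs_instrCode_inactive (addr := addr) X.length u L R J x a p
      rw [seqCode, execs_append, h, ih (by simpa using hJ), h']

/-- The basic action that occurs in an instruction. -/
def Instr.act? : Instr Φ M → Option (Act Φ M)
  | .plain a => some a
  | .pos a => some a
  | .neg a => some a
  | .jump _ => none
  | .halt => none

theorem lt_length_of_run_eq_some {A : Set (Focus Φ)} {X : List (Instr Φ M)} {k : ℕ}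
    {ρ : Focus Φ → Bool} {c : Bool} (h : run A X k ρ = some c) : k < X.length := by
  induction X generalizing k with
  | nil => simp [run] at h
  | cons u X ih =>
    obtain _ | k := k
    · simp
    · rw [run] at h
      simpa using ih h

/-- The interpreter follows every run that terminates. The set `B` consists of those registers that
are kept on the tape. -/
theorem execs_seqCode {A B : Set (Focus Φ)} (hB : Set.InjOn addr B) (ho : .out ∈ B)
    (haddr : addr .out = 0) (X : List (Instr Φ M)) (hX : ∀ u ∈ X, BrInstr u)
    (hXB : ∀ u ∈ X, ∀ a ∈ u.act?, a.focus ∈ A → a.focus ∈ B) {k : ℕ} {ρ : Focus Φ → Bool} {c : Bool}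
    (hrun : run A X k ρ = some c) {L R J : List Bool} {a p : Bool} (hL : Represents addr B L ρ)
    (hJ : J.length = k) :
    (execs (seqCode addr X) ⟨L, R, J, a, p⟩).L.getD 0 false = c := by
  induction X generalizing L J a p k ρ with
  | nil => simp [run] at hrun
  | cons u X ih =>
    have hu := hX u (by simp)
    have huB := hXB u (by simp)
    have ih := fun {k : ℕ} {ρ : Focus Φ → Bool} (h : run A X k ρ = some c) {L J : List Bool}
      {a p : Bool} => @ih (fun v hv => hX v (by simp [hv])) (fun v hv => hXB v (by simp [hv])) k ρ h
        L J a p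
    obtain _ | ⟨x, J⟩ := J
    · subst hJ
      rw [seqCode, execs_append]
      cases u with
      | plain b =>
        simp only [List.length_nil, run, Option.ite_none_right_eq_some] at hrun
        obtain ⟨L', h, h'⟩ := execs_actCode hB hu (huB b rfl hrun.1) hL R []
        rw [instrCode, execs_cons, Op.exec]
        erw [h]
        exact ih hrun.2 h' rfl
      | pos b =>
        simp only [List.length_nil, run, Option.ite_none_right_eq_some] at hrun
        obtain ⟨L', h, h'⟩ := execs_actCode hB hu (huB b rfl hrun.1) hL R []
        rw [instrCode, execs_cons, Op.exec, execs_append]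
        erw [h]
        refine ih hrun.2 h' ?_
        cases b.upd ρ b.focus <;> rfl
      | neg b =>
        simp only [List.length_nil, run, Option.ite_none_right_eq_some] at hrun
        obtain ⟨L', h, h'⟩ := execs_actCode hB hu (huB b rfl hrun.1) hL R []
        rw [instrCode, execs_cons, Op.exec, execs_append]
        erw [h]
        refine ih hrun.2 h' ?_
        cases b.upd ρ b.focus <;> rfl
      | jump l =>
        cases l with
        | zero => simp [run] at hrun
        | succ l =>
          simp only [List.length_nil, run] at hrun
          have hl : l ≤ X.length := (lt_length_of_run_eq_some hrun).le
          rw [instrCode, execs_cons, Op.exec]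
          erw [execs_replicate_skip]
          exact ih hrun hL (by simpa using hl)
      | halt =>
        simp only [List.length_nil, run, Option.some.injEq] at hrun
        rw [instrCode, execs_cons, Op.exec]
        erw [execs_replicate_skip]
        rw [execs_seqCode_inactive _ (by simp), ← hrun, ← hL _ ho, haddr]
    · subst hJ
      obtain ⟨L', p', h, h'⟩ := execs_instrCode_inactive (addr := addr) X.length u L R J x a p
      rw [seqCode, execs_append, h]
      exact ih hrun (fun f hf => (h' _).trans (hL f hf)) rfl

theorem length_seqCode_le {N : ℕ} (haddr : ∀ f, addr f ≤ N) (X : List (Instr Φ M)) {m : ℕ}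
    (hm : X.length ≤ m) : (seqCode addr X).length ≤ X.length * (2 * N + m + 5) := by
  induction X with
  | nil => simp [seqCode]
  | cons u X ih =>
    have hact : ∀ a : Act Φ M, (actCode addr a).length ≤ 2 * N + 2 := by
      intro a
      have := haddr a.focus
      rw [actCode]
      split <;> simp [opAt] <;> omega
    have hu : (instrCode addr X.length u).length ≤ 2 * N + m + 5 := by
      simp only [List.length_cons] at hm
      cases u with
      | plain a | pos a | neg a =>
        have := hact a
        simp [instrCode]
        omega
      | jump l | halt =>
        simp [instrCode]
        omega
    simp only [List.length_cons] at hm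
    rw [seqCode, List.length_append, List.length_cons, add_mul, one_mul, add_comm]
    exact Nat.add_le_add (ih (by omega)) hu

open Classical in
/-- The addresses of registers: `out` comes first, followed by the inputs in reverse order and the
registers in the list `S`. The index of an auxiliary register in `S` is used in place of its number,
which is not bounded in terms of the length of the instruction sequence. -/
noncomputable def address (n : ℕ) (S : List (Focus Φ)) : Focus Φ → ℕ
  | .inp i => n + 1 - i
  | .aux i => n + 1 + S.idxOf (.aux i)
  | _ => 0

/-- An instruction sequence is compiled to an advice string of polynomial length. -/
theorem exists_advice {n : ℕ} {X : FIS Φ M} (hX : X ∈ ISbr Φ M) {f : (Fin n → Bool) → Bool}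
    (hf : Computes X f) :
    ∃ a : List Bool, a.length ≤ 3 * (X.psize * (2 * (n + 1 + X.psize) + X.psize + 5)) ∧
      ∀ b, interpret (List.ofFn b, a) = f b := by
  classical
  obtain ⟨l, hl⟩ := (computes_iff hX f).1 hf
  -- The registers that occur in `X`; only those that are available can be addressed in a run.
  let S : List (Focus Φ) := X.1.filterMap fun u => u.act?.map Act.focus
  have hS : S.length ≤ X.psize := List.length_filterMap_le _ _
  let addr := address n S
  have haddr : ∀ g, addr g ≤ n + 1 + X.psize := by
    intro g
    cases g with
    | inp i => simp [addr, address]; omega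
    | aux i =>
      have : S.idxOf (.aux i) ≤ S.length := List.idxOf_le_length
      simp [addr, address]
      omega
    | out => simp [addr, address]
    | other x => simp [addr, address]
  let B : Set (Focus Φ) := {g | g ∈ avail Φ n l ∧ (g ∈ S ∨ g = .out)}
  have hB : Set.InjOn addr B := by
    rintro g ⟨hg, hgS⟩ g' ⟨hg', hgS'⟩ h
    have hinp : ∀ i : ℕ+, .inp i ∈ avail Φ n l → (i : ℕ) ≤ n := fun _ h => h
    have hoth : ∀ x, .other x ∉ avail Φ n l := fun _ h => h
    rcases g with i | i | _ | x <;> rcases g' with j | j | _ | y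
    case other.inp | other.aux | other.out | other.other => exact (hoth x hg).elim
    case inp.other | aux.other | out.other => exact (hoth y hg').elim
    case out.out => rfl
    case aux.aux =>
      refine (List.idxOf_inj (l := S) (by simpa using hgS)).1 ?_
      simpa [addr, address] using h
    all_goals simp only [addr, address] at h
    case inp.inp =>
      have := hinp i hg
      have := hinp j hg'
      rw [PNat.coe_inj.1 (show (i : ℕ) = j by omega)]
    case inp.aux | inp.out =>
      have := hinp i hg
      have := i.pos
      omega
    case aux.inp | out.inp =>
      have := hinp j hg'
      have := j.pos
      omega
    all_goals omega
  refine ⟨(seqCode addr X.1).flatMap Op.bits, ?_, fun b => ?_⟩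
  · rw [length_flatMap_bits]
    exact Nat.mul_le_mul_left 3 (length_seqCode_le haddr X.1 le_rfl)
  · rw [interpret, runBits_flatMap_bits, List.head?_eq_getElem?, ← List.getD_eq_getElem?_getD]
    refine execs_seqCode hB ⟨trivial, Or.inr rfl⟩ rfl X.1 hX
      (fun u hu a ha h => ⟨h, Or.inl ?_⟩) (hl b) ?_ rfl
    · exact List.mem_filterMap.2 ⟨u, hu, by rw [ha]; rfl⟩
    · rintro (i | i | _ | x) ⟨hg, hgS⟩
      · have h₁ : (i : ℕ) ≤ n := hg
        have h₂ := i.pos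
        have e : n + 1 - (i : ℕ) = (n - i) + 1 := by omega
        have h₃ : i.natPred < n := (PNat.natPred_add_one i).trans_le hg
        have h₄ : n - 1 - (n - (i : ℕ)) = i.natPred := by
          have := PNat.natPred_add_one i
          omega
        simp only [addr, address, e, List.getD_cons_succ, initReg, h₃, dif_pos]
        rw [List.getD_eq_getElem _ _ (by simp; omega)]
        simp [h₄]
      · rw [List.getD_eq_default]
        · rfl
        · simp [addr, address]
      · rfl
      · rfl

theorem plis_subset_pPolyAdvice : BoolFamily.equivStringFun '' PLIS Φ M ⊆ PPolyAdvice := by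
  rintro _ ⟨F, ⟨h, hF⟩, rfl⟩
  choose X hX hc hl using hF
  choose a ha hi using fun n => exists_advice (hX n) (hc n)
  refine ⟨a, 3 * (h * (2 * (Polynomial.X + 1 + h) + h + 5)), interpret, fun n => ?_,
    interpret_polyTime, fun w => ?_⟩
  · refine (ha n).trans ?_
    simp only [Polynomial.eval_mul, Polynomial.eval_add, Polynomial.eval_ofNat, Polynomial.eval_X,
      Polynomial.eval_one]
    have := hl n
    gcongr
  · have := hi w.length w.get
    rw [List.ofFn_get] at this
    exact this.symm

end PLISToAdvice

end InstrSeq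

theorem mainTheorem1 (Φ M : Type*) :
    InstrSeq.BoolFamily.equivStringFun '' InstrSeq.PLIS Φ M = InstrSeq.PPolyAdvice ∧
      InstrSeq.BoolFamily.equivStringFun '' InstrSeq.PLIS Φ M = InstrSeq.PPolyCircuit := by
  have h₁ := InstrSeq.plis_subset_pPolyAdvice (Φ := Φ) (M := M)
  have h₂ := InstrSeq.pPolyAdvice_subset_pPolyCircuit
  have h₃ := InstrSeq.pPolyCircuit_subset_plis (Φ := Φ) (M := M)
  exact ⟨h₁.antisymm (h₂.trans h₃), (h₁.trans h₂).antisymm h₃⟩
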